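/- Let $(\Omega,\mathcal B,P)$ be a probability space, and let $\varphi$ be an Orlicz N-function: $\varphi:\mathbb R\to\mathbb R$ is continuous, even, convex, increasing on $(0,\infty)$, $\varphi(0)=0$, $\varphi(x)/x\to0$ as $x\to0$ and $\varphi(x)/x\to\infty$ as $x\to\infty$. Assume that $\lim_{x\to0}\varphi(x)/x^2$ exists in $(0,+\infty]$. Let $f$ be the density of $\varphi$, that is, the nondecreasing right-continuous function on $[0,\infty)$ with $f(0)=0$, $f(x)\to+\infty$ as $x\to+\infty$ and $\varphi(u)=\int_0^{|u|}f(v)\,dv$. Let $\varphi^*(x)=\sup_{y\in\mathbb R}(xy-\varphi(y))$, and let $\varphi^{(-1)}$ be the inverse of $\varphi$ on $[0,\infty)$. A zero mean random variable $\xi$ belongs to $Sub_\varphi(\Omega)$ if for some $a\ge0$ one has $E e^{\lambda\xi}\le e^{\varphi(a\lambda)}$ for all $\lambda\in\mathbb R$; put $\tau_\varphi(\xi)=\sup_{\lambda\ne0}\varphi^{(-1)}(\ln E e^{\lambda\xi})/|\lambda|$. A process $X(t)$, $t\in\mathbb R$, is strictly $\varphi$-sub-Gaussian with determinative constant $C_X>0$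 if $X(t)\in Sub_\varphi(\Omega)$ for all $t$ and $\tau_\varphi(\xi)\le C_X(E\xi^2)^{1/2}$ for every finite real linear combination $\xi$ of the variables $X(t)$. Let $X(t)$, $t\in\mathbb R$, be a measurable, real-valued, centered, (wide-sense) stationary, mean square continuous process that is strictly $\varphi$-sub-Gaussian with determinative constant $C_X$. Let $B(\tau)=E\,X(t+\tau)X(t)$ be its covariance function and $F$ its spectral measure, so that $F$ is finite and $B(\tau)=\int_{\mathbb R}e^{i\tau\lambda}\,dF(\lambda)$. Let $0<\Lambda<\omega$, $T>0$, $p\ge1$, $z\in(0,1)$, and let $n$ be a natural number with $n\ge\frac{\omega T}{\pi\sqrt z}$. Put \[X_n(t)=\sum_{k=-n}^n\frac{\sin\left(\omega\left(t-\frac{k\pi}{\omega}\right)\right)}{\omega\left(t-\frac{k\pi}{\omega}\right)}\,X\!\left(\frac{k\pi}{\omega}\right)\] (the quotient being $1$ at $t=k\pi/\omega$), and, for $t\in[0,T]$, \[A_n(t,\Lambda)=\frac{\sqrt{C_n(t,\Lambda)}}{n}+D_n(t)\left(\int_{|\lambda|>\Lambda}dF(\lambda)\right)^{1/2},\] \[C_n(t,\Lambda)=B(0)\left(\frac{4\omega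 t}{\pi^2(1-z)}+\frac{4\left(z+1+\frac1n\right)}{\pi(1-z)^2\left(1-\frac{\Lambda}{\omega}\right)}\right)^2,\] \[D_n(t)=2+\frac{2|\sin(\omega t)|}{\pi}\left(1+\mathrm{Si}(\pi)+\frac{\frac{\omega t}{\pi}+\frac12}{n-\frac{\omega t}{\pi}}\right),\qquad \mathrm{Si}(\pi)=\int_0^\pi\frac{\sin x}{x}\,dx,\] \[S_{n,p}=C_X^p\int_0^TA_n^p(t,\Lambda)\,dt.\] Then $\int_0^T|X(t)-X_n(t)|^p\,dt$ exists with probability $1$, and for every $\varepsilon>0$ with $\varepsilon>S_{n,p}\cdot\left(f\left(p\,(S_{n,p}/\varepsilon)^{1/p}\right)\right)^p$, \[P\left\{\int_0^T|X(t)-X_n(t)|^p\,dt>\varepsilon\right\}\le2\exp\left\{-\varphi^*\left(\left(\varepsilon/S_{n,p}\right)^{1/p}\right)\right\}.\] Here, if $S_{n,p}=0$, the right-hand side is understood as $0$ (i.e. $\varepsilon/0=\varphi^*(+\infty)=+\infty$). -/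

import Mathlib

open MeasureTheory ProbabilityTheory Filter Topology

noncomputable section

namespace WKS

/-! ### Orlicz N-functions -/

/-- Orlicz N-functions: continuous even convex functions on the line, increasing on `(0, ∞)`,
vanishing at `0`, with `φ x / x → 0` as `x → 0` and `φ x / x → ∞` as `x → ∞`. -/
structure IsNFunction (φ : ℝ → ℝ) : Prop where
  continuous : Continuous φ
  even : ∀ x, φ (-x) = φ x
  convex : ConvexOn ℝ Set.univ φ
  strictMonoOn : StrictMonoOn φ (Set.Ioi 0)
  map_zero : φ 0 = 0
  tendsto_zero : Tendsto (fun x => φ x / x) (𝓝[≠] 0) (𝓝 0)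
  tendsto_atTop : Tendsto (fun x => φ x / x) atTop atTop

/-- Condition Q: the limit of `φ x / x ^ 2` at `0` exists and is positive, possibly `+∞`. -/
def ConditionQ (φ : ℝ → ℝ) : Prop :=
  (∃ C : ℝ, 0 < C ∧ Tendsto (fun x => φ x / x ^ 2) (𝓝[≠] 0) (𝓝 C)) ∨
    Tendsto (fun x => φ x / x ^ 2) (𝓝[≠] 0) atTop

/-- The Young-Fenchel transform `φ* x = sup_y (x y - φ y)`.
For an N-function the supremum is over a set that is bounded above. -/
def youngFenchel (φ : ℝ → ℝ) (x : ℝ) : ℝ := ⨆ y : ℝ, (x * y - φ y)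

/-- `f` is the density of `φ`: `φ u = ∫_0^{|u|} f`, with `f` nondecreasing and right-continuous on
`[0, ∞)`, `f 0 = 0` and `f x → ∞` as `x → ∞`. Values of `f` on `(-∞, 0)` play no role. -/
structure IsDensity (φ f : ℝ → ℝ) : Prop where
  eq_integral : ∀ u, φ u = ∫ v in (0 : ℝ)..|u|, f v
  monotoneOn : MonotoneOn f (Set.Ici 0)
  rightContinuous : ∀ x, 0 ≤ x → ContinuousWithinAt f (Set.Ici x) x
  map_zero : f 0 = 0
  tendsto_atTop : Tendsto f atTop atTop

/-- The inverse of the bijection `φ : [0, ∞) → [0, ∞)`. -/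
def phiInv (φ : ℝ → ℝ) (y : ℝ) : ℝ := Function.invFunOn φ (Set.Ici 0) y

section Probability

variable {Ω : Type*} [MeasurableSpace Ω]

/-! ### `φ`-sub-Gaussian random variables and strictly `φ`-sub-Gaussian processes -/

/-- `ξ` belongs to `Sub_φ(Ω)`: it has zero mean and, for some `a ≥ 0`,
`E exp(l ξ) ≤ exp(φ(a l))` for all real `l` (in particular the expectation is finite). -/
structure IsSub (φ : ℝ → ℝ) (P : Measure Ω) (ξ : Ω → ℝ) : Prop where
  integrable : Integrable ξ P
  mean_zero : ∫ ω, ξ ω ∂P = 0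
  exp_bound : ∃ a : ℝ, 0 ≤ a ∧ ∀ l : ℝ,
    Integrable (fun ω => Real.exp (l * ξ ω)) P ∧
      ∫ ω, Real.exp (l * ξ ω) ∂P ≤ Real.exp (φ (a * l))

/-- The norm `τ_φ(ξ) = sup_{l ≠ 0} φ⁻¹(log E exp(l ξ)) / |l|`, as an extended nonnegative number
(it is finite on `Sub_φ(Ω)`). -/
def tau (φ : ℝ → ℝ) (P : Measure Ω) (ξ : Ω → ℝ) : ENNReal :=
  ⨆ (l : ℝ) (_ : l ≠ 0),
    ENNReal.ofReal (phiInv φ (Real.log (∫ ω, Real.exp (l * ξ ω) ∂P)) / |l|)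

/-- The family `Ξ` of random variables is strictly `Sub_φ(Ω)`
and `C` is a determinative constant of it. -/
structure IsStrictlySub (φ : ℝ → ℝ) (P : Measure Ω) (Ξ : Set (Ω → ℝ)) (C : ℝ) : Prop where
  isSub : ∀ ξ ∈ Ξ, IsSub φ P ξ
  pos : 0 < C
  tau_le : ∀ (I : Finset ℕ) (ξ : ℕ → Ω → ℝ) (c : ℕ → ℝ), (∀ i ∈ I, ξ i ∈ Ξ) →
    tau φ P (fun ω => ∑ i ∈ I, c i * ξ i ω) ≤
      ENNReal.ofReal (C * √(∫ ω, (∑ i ∈ I, c i * ξ i ω) ^ 2 ∂P))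

/-- The process `X` is strictly `Sub_φ(Ω)` with determinative constant `C`. -/
def IsStrictlySubProcess (φ : ℝ → ℝ) (P : Measure Ω) (X : ℝ → Ω → ℝ) (C : ℝ) : Prop :=
  IsStrictlySub φ P (Set.range X) C

/-! ### Stationary processes -/

/-- The covariance function `B(τ) = E X(τ) X(0)` of a centered stationary process. -/
def covFun (P : Measure Ω) (X : ℝ → Ω → ℝ) (τ : ℝ) : ℝ := ∫ ω, X τ ω * X 0 ω ∂P

/-- Centered, wide-sense stationary, mean square continuous real processes. -/
structure IsStationary (P : Measure Ω) (X : ℝ → Ω → ℝ) : Prop where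
  memLp : ∀ t, MemLp (X t) 2 P
  mean_zero : ∀ t, ∫ ω, X t ω ∂P = 0
  cov_eq : ∀ t τ, ∫ ω, X (t + τ) ω * X t ω ∂P = covFun P X τ
  meanSquareContinuous : ∀ t,
    Tendsto (fun s => ∫ ω, (X s ω - X t ω) ^ 2 ∂P) (𝓝 t) (𝓝 0)

/-- `F` is the spectral measure of `X`: the finite measure on the line
with `B(τ) = ∫ exp(i τ x) dF(x)` for all `τ`. -/
structure IsSpectralMeasure (P : Measure Ω) (X : ℝ → Ω → ℝ) (F : Measure ℝ) : Prop where
  finite : IsFiniteMeasure F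
  cov_eq : ∀ τ : ℝ, (covFun P X τ : ℂ) = ∫ x : ℝ, Complex.exp (Complex.I * τ * x) ∂F

/-! ### The truncated Whittaker-Kotel'nikov-Shannon sum and the error bounds -/

/-- The truncated sampling sum
`X_n(t) = ∑_{k=-n}^n sinc(w (t - k π / w)) X(k π / w)`, where `sinc u = sin u / u`, `sinc 0 = 1`. -/
def truncSum (w : ℝ) (n : ℕ) (X : ℝ → Ω → ℝ) (t : ℝ) (ω : Ω) : ℝ :=
  ∑ k ∈ Finset.Icc (-(n : ℤ)) (n : ℤ),
    Real.sinc (w * (t - k * Real.pi / w)) * X (k * Real.pi / w) ω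

/-- The sine integral `Si(x) = ∫_0^x sin u / u du`. -/
def sineIntegral (x : ℝ) : ℝ := ∫ u in (0 : ℝ)..x, Real.sin u / u

/-- The coefficient `C_n(t, Λ)`, with `B0 = B(0)`. -/
def coeffC (B0 w z Λ : ℝ) (n : ℕ) (t : ℝ) : ℝ :=
  B0 * (4 * w * t / (Real.pi ^ 2 * (1 - z)) +
    4 * (z + 1 + 1 / (n : ℝ)) / (Real.pi * (1 - z) ^ 2 * (1 - Λ / w))) ^ 2

/-- The coefficient `D_n(t)`. -/
def coeffD (w : ℝ) (n : ℕ) (t : ℝ) : ℝ :=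
  2 + 2 * |Real.sin (w * t)| / Real.pi *
    (1 + sineIntegral Real.pi + (w * t / Real.pi + 1 / 2) / ((n : ℝ) - w * t / Real.pi))

/-- The mean square error bound `A_n(t, Λ)`. -/
def boundA (P : Measure Ω) (X : ℝ → Ω → ℝ) (F : Measure ℝ) (w z Λ : ℝ) (n : ℕ) (t : ℝ) : ℝ :=
  √(coeffC (covFun P X 0) w z Λ n t) / (n : ℝ) +
    coeffD w n t * √(F.real {x : ℝ | Λ < |x|})

/-- `S_{n,p} = C_X ^ p ∫_0^T A_n(t, Λ) ^ p dt`. -/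
def boundS (P : Measure Ω) (X : ℝ → Ω → ℝ) (F : Measure ℝ) (CX w z Λ T p : ℝ) (n : ℕ) : ℝ :=
  CX ^ p * ∫ t in (0 : ℝ)..T, (boundA P X F w z Λ n t) ^ p

end Probability

end WKS

end

/-! The error `X(t) - X_n(t)` is a finite linear combination of values of the process. Strict
sub-Gaussianity therefore bounds its exponential moments in terms of its `L²` norm alone. By the
spectral isometry, the square of that norm is the `F`-integral of `|e^{itλ} - K_n(t, λ)|²`, where
`K_n` is the truncated cardinal series of the exponential.

This kernel is estimated separately on the two sides of `|λ| = Λ`. Inside the band, multiplication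
by `1 + e^{iθ}` (with `θ = πλ/ω`) turns the cardinal series into an absolutely convergent Fourier
series whose tail telescopes; dividing back gives an error of order `1/n`
(`norm_exp_sub_sum_cardTerm_le`). Outside, the symmetric partial sums are bounded uniformly in the
frequency: pairing the terms around the integer nearest to `ωt/π` produces partial sums of the
sawtooth series, which never exceed `Si(π)` (`abs_sinSum_le`, `norm_sum_cardTerm_le`). Together
these give the `L²` bound `A_n(t, Λ)` (`sqrt_integral_sq_le_boundA`).

For the tail, put `τ = C_X A_n`, `S = ∫ τ^p` and `ε = c^p S`. The functional `∫ τ^p exp(v|Y|/τ) dt`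
has expectation at most `2 S e^{φ(v)}`. Bernoulli's inequality shows that `∫ |Y|^p > c^p S` forces
it to be at least `S e^{cv}` whenever `cv ≥ p`, so Markov's inequality yields `2 exp(-(cv - φ(v)))`.
The condition on `ε` says that `f(p/c)` does not exceed `c`; then `cv - φ(v)` is nowhere larger on
`v ≤ p/c` than at `p/c`, the restriction on `v` costs nothing, and the supremum over all `v` is
`φ*(c)`. -/

noncomputable section

namespace WKS

/-! ### Sawtooth partial sums and the Gibbs constant `Si(π)`. -/

/-- The partial sum `∑_{j=1}^J sin (j θ) / j` of the sawtooth Fourier series. -/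
def sinSum (J : ℕ) (θ : ℝ) : ℝ := ∑ j ∈ Finset.range J, Real.sin ((j + 1) * θ) / (j + 1)

theorem two_sin_half_mul_sum_cos (J : ℕ) (θ : ℝ) :
    2 * Real.sin (θ / 2) * ∑ j ∈ Finset.range J, Real.cos ((j + 1) * θ) =
      Real.sin ((J + 1 / 2) * θ) - Real.sin (θ / 2) := by
  induction J with
  | zero => simp; ring_nf
  | succ J ih =>
    rw [Finset.sum_range_succ, mul_add, ih]
    have h1 : ((J : ℝ) + 1 / 2) * θ = (J + 1) * θ - θ / 2 := by ring
    have h2 : ((J + 1 : ℕ) + 1 / 2) * θ = (J + 1) * θ + θ / 2 := by push_cast; ring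
    rw [h1, h2, Real.sin_sub, Real.sin_add]
    ring

theorem hasDerivAt_sinSum (J : ℕ) (θ : ℝ) :
    HasDerivAt (sinSum J) (∑ j ∈ Finset.range J, Real.cos ((j + 1) * θ)) θ := by
  unfold sinSum
  refine HasDerivAt.fun_sum fun j _ => ?_
  have h0 : (j : ℝ) + 1 ≠ 0 := by positivity
  have h := (((hasDerivAt_id θ).const_mul ((j : ℝ) + 1)).sin).div_const ((j : ℝ) + 1)
  refine h.congr_deriv ?_
  field_simp
  rfl

theorem continuous_sinSum (J : ℕ) : Continuous (sinSum J) :=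
  continuous_iff_continuousAt.2 fun θ => (hasDerivAt_sinSum J θ).continuousAt

/-- The Fejér-Jackson inequality. -/
theorem sinSum_nonneg (J : ℕ) : ∀ θ ∈ Set.Icc 0 Real.pi, 0 ≤ sinSum J θ := by
  induction J with
  | zero => intro θ _; simp [sinSum]
  | succ J ih =>
    obtain ⟨m, hm, hmin⟩ := isCompact_Icc.exists_isMinOn
      (Set.nonempty_Icc.2 Real.pi_pos.le) (continuous_sinSum (J + 1)).continuousOn
    suffices h : 0 ≤ sinSum (J + 1) m from fun θ hθ => h.trans (hmin hθ)
    rcases hm.1.eq_or_lt with h0 | h0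
    · simp [sinSum, ← h0]
    rcases hm.2.eq_or_lt with h1 | h1
    · rw [h1, sinSum]
      refine Finset.sum_nonneg fun j _ => ?_
      have : Real.sin (((j : ℝ) + 1) * Real.pi) = 0 := by
        have := Real.sin_nat_mul_pi (j + 1)
        rwa [Nat.cast_add_one] at this
      simp [this]
    -- At an interior minimum the cosine sum vanishes, so the closed form gives `sin ((J + 3/2) m) =
    -- sin (m/2)`.
    have hd := (hmin.isLocalMin (Icc_mem_nhds h0 h1)).hasDerivAt_eq_zero
      (hasDerivAt_sinSum (J + 1) m)
    have hs := two_sin_half_mul_sum_cos (J + 1) m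
    rw [hd, mul_zero] at hs
    have hp : 0 < Real.sin (m / 2) := Real.sin_pos_of_pos_of_lt_pi (by linarith) (by linarith)
    -- With `u = (J + 3/2) m`, the sine equals `sin (m/2) (cos (m/2) - cos u)`, and `|cos u| = cos
    -- (m/2)` because the sines agree. So the last term of the sum is nonnegative at the minimum,
    -- and the induction hypothesis handles the others.
    have hsin : 0 ≤ Real.sin ((J + 1) * m) := by
      have e : ((J : ℝ) + 1) * m = ((J + 1 : ℕ) + 1 / 2) * m - m / 2 := by push_cast; ring
      have hc : 0 ≤ Real.cos (m / 2) :=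
        Real.cos_nonneg_of_neg_pi_div_two_le_of_le (by linarith) (by linarith)
      set u := ((J + 1 : ℕ) + 1 / 2) * m
      have h3 : Real.cos u ≤ Real.cos (m / 2) := by
        have h4 := Real.sin_sq_add_cos_sq u
        have h5 := Real.sin_sq_add_cos_sq (m / 2)
        have h6 : Real.sin u = Real.sin (m / 2) := by linarith
        rw [h6] at h4
        exact (le_abs_self _).trans (abs_le_of_sq_le_sq (by linarith) hc)
      rw [e, Real.sin_sub, show Real.sin u = Real.sin (m / 2) by linarith]
      nlinarith
    have e : sinSum (J + 1) m = sinSum J m + Real.sin ((J + 1) * m) / (J + 1) :=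
      Finset.sum_range_succ _ _
    rw [e]
    exact add_nonneg (ih m hm) (div_nonneg hsin (by positivity))

theorem sineIntegral_eq_integral_sinc (x : ℝ) :
    sineIntegral x = ∫ u in (0 : ℝ)..x, Real.sinc u := by
  refine intervalIntegral.integral_congr_ae ?_
  have : ∀ᵐ u : ℝ, u ≠ 0 := by simp [ae_iff, measure_singleton]
  filter_upwards [this] with u hu _
  rw [Real.sinc_of_ne_zero hu]

theorem hasDerivAt_sineIntegral (x : ℝ) : HasDerivAt sineIntegral (Real.sinc x) x := by
  have : sineIntegral = fun x => ∫ u in (0 : ℝ)..x, Real.sinc u :=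
    funext sineIntegral_eq_integral_sinc
  rw [this]
  exact intervalIntegral.integral_hasDerivAt_right
    (Real.continuous_sinc.intervalIntegrable _ _)
    (Real.continuous_sinc.stronglyMeasurableAtFilter _ _) Real.continuous_sinc.continuousAt

theorem continuous_sineIntegral : Continuous sineIntegral :=
  continuous_iff_continuousAt.2 fun x => (hasDerivAt_sineIntegral x).continuousAt

theorem sineIntegral_zero : sineIntegral 0 = 0 := by simp [sineIntegral]

/-- On `[0, π]` the integrand is nonnegative. Beyond `π`, the corrected function `Si(u) + (1 + cos
u)/u` has derivative `-(1 + cos u)/u²`, and the nonnegative correction vanishes at `π`. -/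
theorem sineIntegral_le_pi {x : ℝ} (hx : 0 ≤ x) : sineIntegral x ≤ sineIntegral Real.pi := by
  rcases le_total x Real.pi with h | h
  · have hm : MonotoneOn sineIntegral (Set.Icc 0 Real.pi) := by
      refine monotoneOn_of_hasDerivWithinAt_nonneg (convex_Icc _ _)
        continuous_sineIntegral.continuousOn
        (fun x _ => (hasDerivAt_sineIntegral x).hasDerivWithinAt) fun u hu => ?_
      rw [interior_Icc] at hu
      rw [Real.sinc_of_ne_zero hu.1.ne']
      exact div_nonneg (Real.sin_pos_of_pos_of_lt_pi hu.1 hu.2).le hu.1.le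
    exact hm ⟨hx, h⟩ ⟨Real.pi_pos.le, le_rfl⟩ h
  · have hne : ∀ u ∈ Set.Ici Real.pi, u ≠ 0 := fun u hu => (Real.pi_pos.trans_le hu).ne'
    have hd : ∀ u ∈ Set.Ici Real.pi,
        HasDerivAt (fun u => sineIntegral u + (1 + Real.cos u) / u)
          (-((1 + Real.cos u) / u ^ 2)) u := by
      intro u hu
      have h1 := (hasDerivAt_sineIntegral u).add
        (((Real.hasDerivAt_cos u).const_add 1).div (hasDerivAt_id u) (hne u hu))
      refine h1.congr_deriv ?_
      rw [Real.sinc_of_ne_zero (hne u hu)]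
      have := hne u hu
      simp only [id]
      field_simp
      ring
    have ha : AntitoneOn (fun u => sineIntegral u + (1 + Real.cos u) / u) (Set.Ici Real.pi) := by
      refine antitoneOn_of_hasDerivWithinAt_nonpos (convex_Ici _)
        (fun u hu => (hd u hu).continuousAt.continuousWithinAt)
        (fun u hu => (hd u (interior_subset hu)).hasDerivWithinAt) fun u hu => ?_
      have := Real.neg_one_le_cos u
      have : 0 ≤ (1 + Real.cos u) / u ^ 2 := div_nonneg (by linarith) (sq_nonneg u)
      linarith
    have h2 := ha (Set.self_mem_Ici) h h
    have h3 := Real.neg_one_le_cos x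
    have h4 : 0 ≤ (1 + Real.cos x) / x := div_nonneg (by linarith) hx
    simp only [Real.cos_pi, add_neg_cancel, zero_div, add_zero] at h2
    linarith

/-- With `v = u/2` this is `1/(2 sin (u/2)) ≤ 1/u + 1/2`, the form needed to compare the Dirichlet
kernel with `1/u`. -/
theorem div_one_add_le_sin {v : ℝ} (h0 : 0 < v) (h1 : v ≤ Real.pi / 2) :
    v / (1 + v) ≤ Real.sin v := by
  rw [div_le_iff₀ (by linarith)]
  rcases le_total v 1 with h | h
  · have := Real.sin_gt_sub_cube h0
    have h2 : v ≤ (v - v ^ 3 / 6) * (1 + v) := by nlinarith [mul_pos h0 h0, mul_nonneg (mul_pos h0 h0).le (sub_nonneg.2 h), mul_nonneg (mul_nonneg (mul_pos h0 h0).le (sub_nonneg.2 h)) h0.le]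
    nlinarith
  · have := Real.mul_le_sin h0.le h1
    have h3 : v ≤ (2 / Real.pi * v) * (1 + v) := by
      rw [show (2 / Real.pi * v) * (1 + v) = v * ((2 * (1 + v)) / Real.pi) by ring]
      refine le_mul_of_one_le_right h0.le ?_
      rw [one_le_div Real.pi_pos]
      linarith [Real.pi_le_four]
    nlinarith

/-- The difference of the two sides vanishes at `0` and has derivative `sin(Mu) (1/u - 1/(2
sin(u/2))) + 1/2`. The bracket lies in `[-1/2, 0]`, so the derivative is nonnegative. -/
theorem sinSum_le_sineIntegral (J : ℕ) {θ : ℝ} (hθ : θ ∈ Set.Icc 0 Real.pi) :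
    sinSum J θ ≤ sineIntegral ((J + 1 / 2) * θ) := by
  set M : ℝ := J + 1 / 2 with hM
  have hM0 : 0 < M := by positivity
  have hd : ∀ u, HasDerivAt (fun u => sineIntegral (M * u) - sinSum J u)
      (M * Real.sinc (M * u) - ∑ j ∈ Finset.range J, Real.cos ((j + 1) * u)) u := by
    intro u
    have h1 := (hasDerivAt_sineIntegral (M * u)).comp u ((hasDerivAt_id u).const_mul M)
    refine (h1.sub (hasDerivAt_sinSum J u)).congr_deriv ?_
    ring
  have hm : MonotoneOn (fun u => sineIntegral (M * u) - sinSum J u) (Set.Icc 0 Real.pi) := by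
    refine monotoneOn_of_hasDerivWithinAt_nonneg (convex_Icc _ _)
      (fun u _ => (hd u).continuousAt.continuousWithinAt)
      (fun u _ => (hd u).hasDerivWithinAt) fun u hu => ?_
    rw [interior_Icc] at hu
    have hp : 0 < Real.sin (u / 2) :=
      Real.sin_pos_of_pos_of_lt_pi (by linarith [hu.1]) (by linarith [hu.1, hu.2])
    have hs := two_sin_half_mul_sum_cos J u
    have e1 : ∑ j ∈ Finset.range J, Real.cos ((j + 1) * u) =
        Real.sin (M * u) * (1 / (2 * Real.sin (u / 2))) - 1 / 2 := by
      rw [← hM] at hs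
      generalize ∑ j ∈ Finset.range J, Real.cos ((j + 1) * u) = G at hs ⊢
      generalize Real.sin (M * u) = R at hs ⊢
      field_simp
      linarith
    have hu0 := hu.1
    rw [e1, Real.sinc_of_ne_zero (by positivity)]
    have e2 : M * (Real.sin (M * u) / (M * u)) = Real.sin (M * u) * (1 / u) := by field_simp
    rw [e2]
    have l1 : 1 / u ≤ 1 / (2 * Real.sin (u / 2)) := by
      apply one_div_le_one_div_of_le (by positivity)
      linarith [Real.sin_le (show 0 ≤ u / 2 by linarith)]
    have l2 : 1 / (2 * Real.sin (u / 2)) ≤ 1 / u + 1 / 2 := by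
      have h := div_one_add_le_sin (show 0 < u / 2 by linarith) (by linarith [hu.2])
      rw [div_le_iff₀ (by linarith)] at h
      rw [div_add_div _ _ hu0.ne' two_ne_zero, div_le_div_iff₀ (by positivity) (by positivity)]
      linarith
    have := Real.sin_le_one (M * u)
    have := Real.neg_one_le_sin (M * u)
    set r := 1 / (2 * Real.sin (u / 2))
    set q := 1 / u
    nlinarith [mul_nonneg (sub_nonneg.2 l1) (sub_nonneg.2 (Real.sin_le_one (M * u)))]
  have := hm ⟨le_rfl, Real.pi_pos.le⟩ hθ hθ.1
  simp only [mul_zero, sineIntegral_zero, sinSum, Real.sin_zero, zero_div,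
    Finset.sum_const_zero, sub_zero] at this
  simp only [sinSum]
  linarith

theorem sinSum_neg (J : ℕ) (θ : ℝ) : sinSum J (-θ) = -sinSum J θ := by
  simp [sinSum, neg_div]

theorem sinSum_sub_int_mul_two_pi (J : ℕ) (θ : ℝ) (k : ℤ) :
    sinSum J (θ - k * (2 * Real.pi)) = sinSum J θ := by
  refine Finset.sum_congr rfl fun j _ => ?_
  congr 1
  have : ((j : ℝ) + 1) * (θ - k * (2 * Real.pi)) =
      (j + 1) * θ - ((j + 1) * k : ℤ) * (2 * Real.pi) := by
    push_cast; ring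
  rw [this, Real.sin_sub_int_mul_two_pi]

/-- The partial sums of the sawtooth series are bounded by the Gibbs constant. -/
theorem abs_sinSum_le (J : ℕ) (θ : ℝ) : |sinSum J θ| ≤ sineIntegral Real.pi := by
  have key : ∀ θ ∈ Set.Icc 0 Real.pi, |sinSum J θ| ≤ sineIntegral Real.pi := by
    intro θ hθ
    rw [abs_of_nonneg (sinSum_nonneg J θ hθ)]
    exact (sinSum_le_sineIntegral J hθ).trans (sineIntegral_le_pi (by have := hθ.1; positivity))
  set k := round (θ / (2 * Real.pi))
  rw [← sinSum_sub_int_mul_two_pi J θ k]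
  have hk : |θ - k * (2 * Real.pi)| ≤ Real.pi := by
    have h := abs_sub_round (θ / (2 * Real.pi))
    have hp := Real.pi_pos
    have e : θ - k * (2 * Real.pi) = (θ / (2 * Real.pi) - k) * (2 * Real.pi) := by
      field_simp
    rw [e, abs_mul, abs_of_pos (by positivity : 0 < 2 * Real.pi)]
    nlinarith
  rcases abs_cases (θ - k * (2 * Real.pi)) with h | h
  · exact key _ ⟨h.2, h.1 ▸ hk⟩
  · rw [← abs_neg, ← sinSum_neg]; exact key _ ⟨by linarith, by linarith⟩

/-! ### Cardinal series: a bound for partial sums uniform in the frequency. -/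

/-- The term `sinc (π (x - k)) exp (i k θ)` of the cardinal series of `exp (i x θ)`. -/
def cardTerm (x θ : ℝ) (k : ℤ) : ℂ :=
  (Real.sinc (Real.pi * (x - k)) : ℂ) * Complex.exp (Complex.I * k * θ)

theorem exp_I_int_mul_pi (k : ℤ) : Complex.exp (Complex.I * k * Real.pi) = (-1) ^ k := by
  rw [← Complex.exp_pi_mul_I, ← Complex.exp_int_mul]
  ring_nf

theorem norm_exp_I_mul_int_mul (k : ℤ) (θ : ℝ) : ‖Complex.exp (Complex.I * k * θ)‖ = 1 := by
  have : Complex.I * k * θ = ((k * θ : ℝ) : ℂ) * Complex.I := by push_cast; ring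
  rw [this, Complex.norm_exp_ofReal_mul_I]

theorem sinc_pi_mul_sub_int {x : ℝ} {k : ℤ} (h : x ≠ k) :
    Real.sinc (Real.pi * (x - k)) = (-1) ^ k * Real.sin (Real.pi * x) / (Real.pi * (x - k)) := by
  rw [Real.sinc_of_ne_zero (mul_ne_zero Real.pi_ne_zero (sub_ne_zero.2 h)),
    show Real.pi * (x - k) = Real.pi * x - k * Real.pi by ring, Real.sin_sub_int_mul_pi]

/-- The sign `(-1)^k` from `sin (π(x - k))` is absorbed into the phase as a shift of `θ` by `π`,
leaving the Hilbert-type kernel `e^{ikψ}/(x - k)`. -/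
theorem cardTerm_eq {x θ : ℝ} {k : ℤ} (h : x ≠ k) :
    cardTerm x θ k = (Real.sin (Real.pi * x) / Real.pi : ℝ) *
      (Complex.exp (Complex.I * k * (θ + Real.pi : ℝ)) / (x - k : ℝ)) := by
  have hx : ((x : ℂ) - k) ≠ 0 := by
    have := sub_ne_zero.2 h
    exact_mod_cast this
  have hpi : (Real.pi : ℂ) ≠ 0 := by exact_mod_cast Real.pi_ne_zero
  rw [cardTerm, sinc_pi_mul_sub_int h]
  push_cast
  rw [mul_add, Complex.exp_add, exp_I_int_mul_pi]
  field_simp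

theorem norm_cardTerm_le_one (x θ : ℝ) (k : ℤ) : ‖cardTerm x θ k‖ ≤ 1 := by
  rw [cardTerm, norm_mul, norm_exp_I_mul_int_mul, mul_one, Complex.norm_real]
  exact Real.abs_sinc_le_one _

theorem norm_cardTerm {x θ : ℝ} {k : ℤ} (h : x ≠ k) :
    ‖cardTerm x θ k‖ = |Real.sin (Real.pi * x)| / Real.pi / |x - k| := by
  rw [cardTerm_eq h, norm_mul, norm_div, norm_exp_I_mul_int_mul, Complex.norm_real,
    Complex.norm_real, Real.norm_eq_abs, Real.norm_eq_abs, abs_div, abs_of_pos Real.pi_pos]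
  ring

theorem sum_Icc_sub_add {M : Type*} [AddCommMonoid M] (g : ℤ → M) (m : ℤ) (J : ℕ) :
    ∑ k ∈ Finset.Icc (m - J) (m + J), g k =
      g m + ∑ j ∈ Finset.range J, (g (m + (j + 1)) + g (m - (j + 1))) := by
  induction J with
  | zero => simp
  | succ J ih =>
    have e : Finset.Icc (m - (J + 1 : ℕ)) (m + (J + 1 : ℕ)) =
        insert (m + (J + 1)) (insert (m - (J + 1)) (Finset.Icc (m - J) (m + J))) := by
      ext k; simp only [Finset.mem_insert, Finset.mem_Icc]; push_cast; omega
    rw [e, Finset.sum_insert, Finset.sum_insert, ih, Finset.sum_range_succ]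
    · abel
    · simp only [Finset.mem_Icc]; omega
    · simp only [Finset.mem_insert, Finset.mem_Icc]; omega

/-- Telescoping, as `1/(a² - 1/4) = 1/(a - 1/2) - 1/(a + 1/2)`. This is the total of the remainders
in `exists_pair_eq` and accounts for the summand `1` next to `Si(π)` in `D_n`. -/
theorem sum_one_div_sq_sub_quarter_le (J : ℕ) :
    ∑ j ∈ Finset.range J, 1 / (((j : ℝ) + 1) ^ 2 - 1 / 4) ≤ 2 := by
  have : ∑ j ∈ Finset.range J, 1 / (((j : ℝ) + 1) ^ 2 - 1 / 4) =
      2 - 2 / (2 * (J : ℝ) + 1) := by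
    induction J with
    | zero => simp
    | succ J ih =>
      rw [Finset.sum_range_succ, ih]
      have h1 : ((J : ℝ) + 1) ^ 2 - 1 / 4 = (2 * J + 1) * (2 * J + 3) / 4 := by ring
      have h2 : (2 * (J : ℝ) + 1) ≠ 0 := by positivity
      have h3 : (2 * (J : ℝ) + 3) ≠ 0 := by positivity
      have h4 : (2 * ((J + 1 : ℕ) : ℝ) + 1) = 2 * J + 3 := by push_cast; ring
      rw [h1, h4]
      field_simp
      ring
  rw [this]
  have : 0 ≤ 2 / (2 * (J : ℝ) + 1) := by positivity
  linarith

/-- Symmetric pairs of the Hilbert-type kernel split into a sine term and a summable remainder. -/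
theorem exists_pair_eq (d ψ : ℝ) (hd : |d| ≤ 1 / 2) (j : ℕ) :
    ∃ R : ℂ, ‖R‖ ≤ 1 / (((j : ℝ) + 1) ^ 2 - 1 / 4) ∧
      Complex.exp (Complex.I * ((j : ℂ) + 1) * ψ) / (d - (j + 1) : ℝ) +
        Complex.exp (-(Complex.I * ((j : ℂ) + 1) * ψ)) / (d + (j + 1) : ℝ) =
      -(2 * Complex.I) * ((Real.sin ((j + 1) * ψ) / (j + 1) : ℝ) : ℂ) + R := by
  have hj : (1 : ℝ) ≤ j + 1 := by linarith [j.cast_nonneg (α := ℝ)]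
  have hjc : ((j : ℂ) + 1) = (((j : ℝ) + 1 : ℝ) : ℂ) := by push_cast; ring
  rw [hjc]
  generalize (j : ℝ) + 1 = a at hj ⊢
  have had := abs_le.1 hd
  have h1 : d - a < 0 := by linarith
  have h2 : 0 < d + a := by linarith
  set e := Complex.exp (Complex.I * a * ψ) with he
  set e' := Complex.exp (-(Complex.I * a * ψ)) with he'
  have hne : ‖e‖ = 1 := by
    rw [he, show Complex.I * a * ψ = ((a * ψ : ℝ) : ℂ) * Complex.I by push_cast; ring,
      Complex.norm_exp_ofReal_mul_I]
  have hne' : ‖e'‖ = 1 := by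
    rw [he', show -(Complex.I * a * ψ) = ((-(a * ψ) : ℝ) : ℂ) * Complex.I by push_cast; ring,
      Complex.norm_exp_ofReal_mul_I]
  have hsin : ((Real.sin (a * ψ) : ℝ) : ℂ) = (e' - e) * Complex.I / 2 := by
    rw [Complex.ofReal_sin, Complex.sin, he, he']
    push_cast
    ring_nf
  -- The remainder comes from `1/(d - a) = -1/a + d/(a(d - a))` and `1/(d + a) = 1/a - d/(a(d +
  -- a))`; the parts `∓1/a` combine into the sine.
  refine ⟨e * (d / (a * (d - a)) : ℝ) - e' * (d / (a * (d + a)) : ℝ), ?_, ?_⟩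
  · calc _ ≤ ‖e * ((d / (a * (d - a)) : ℝ) : ℂ)‖ + ‖e' * ((d / (a * (d + a)) : ℝ) : ℂ)‖ :=
        norm_sub_le _ _
      _ = |d| / (a * (a - d)) + |d| / (a * (d + a)) := by
        rw [norm_mul, norm_mul, hne, hne', one_mul, one_mul, Complex.norm_real, Complex.norm_real,
          Real.norm_eq_abs, Real.norm_eq_abs, abs_div, abs_div, abs_mul, abs_mul, abs_of_neg h1,
          abs_of_pos h2, abs_of_pos (by linarith : 0 < a), neg_sub]
      _ = 2 * |d| / (a ^ 2 - d ^ 2) := by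
        have h3 : a - d ≠ 0 := by linarith
        have h4 : d + a ≠ 0 := h2.ne'
        have h5 : a ≠ 0 := by linarith
        rw [show a ^ 2 - d ^ 2 = (a - d) * (d + a) by ring]
        field_simp
        ring
      _ ≤ 1 / (a ^ 2 - 1 / 4) := by
        have h3 : d ^ 2 ≤ 1 / 4 := by nlinarith [sq_abs d, abs_nonneg d]
        apply div_le_div₀ zero_le_one (by linarith) (by nlinarith) (by linarith)
  · have h3 : ((d : ℂ) - a) ≠ 0 := by exact_mod_cast h1.ne
    have h4 : ((d : ℂ) + a) ≠ 0 := by exact_mod_cast h2.ne'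
    have h5 : (a : ℂ) ≠ 0 := by
      have : a ≠ 0 := by linarith
      exact_mod_cast this
    rw [Complex.ofReal_div, hsin]
    push_cast
    field_simp
    ring_nf
    rw [Complex.I_sq]
    ring

/-- A bound for the symmetric partial sums of the cardinal series, uniform in the frequency. -/
theorem norm_sum_cardTerm_le (x θ : ℝ) (n : ℕ) (hx : 0 ≤ x) (hxn : x < n) :
    ‖∑ k ∈ Finset.Icc (-(n : ℤ)) n, cardTerm x θ k‖ ≤
      1 + 2 * |Real.sin (Real.pi * x)| / Real.pi *
        (1 + sineIntegral Real.pi + (x + 1 / 2) / (n - x)) := by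
  set m := round x with hm
  have hd : |x - m| ≤ 1 / 2 := abs_sub_round x
  have hd' := abs_le.1 hd
  have hm0 : 0 ≤ m := by
    have : (-1 : ℝ) < m := by linarith
    have : (-1 : ℤ) < m := by exact_mod_cast this
    omega
  have hmn : m ≤ n := by
    have : (m : ℝ) < n + 1 := by linarith
    have : m < (n : ℤ) + 1 := by exact_mod_cast this
    omega
  -- The window `[m - J, m + J]` is centred at the nearest integer `m` and ends at `n`, so its terms
  -- pair up. The `2m` indices left over below it are all at distance at least `n - x` from `x`.
  obtain ⟨J, hJ⟩ : ∃ J : ℕ, (J : ℤ) = n - m := ⟨((n : ℤ) - m).toNat, by omega⟩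
  set σ := |Real.sin (Real.pi * x)| with hσ
  have hσ0 : 0 ≤ σ := abs_nonneg _
  have hπ := Real.pi_pos
  have hsplit : ∑ k ∈ Finset.Icc (-(n : ℤ)) n, cardTerm x θ k =
      ∑ k ∈ Finset.Ico (-(n : ℤ)) (m - J), cardTerm x θ k +
        ∑ k ∈ Finset.Icc (m - J) (m + J), cardTerm x θ k := by
    rw [← Finset.sum_union]
    · congr 1
      ext k; simp only [Finset.mem_union, Finset.mem_Icc, Finset.mem_Ico]; omega
    · rw [Finset.disjoint_left]
      intro k; simp only [Finset.mem_Icc, Finset.mem_Ico]; omega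
  have hleft : ‖∑ k ∈ Finset.Ico (-(n : ℤ)) (m - J), cardTerm x θ k‖ ≤
      2 * σ / Real.pi * ((x + 1 / 2) / (n - x)) := by
    have hb : ∀ k ∈ Finset.Ico (-(n : ℤ)) (m - J),
        ‖cardTerm x θ k‖ ≤ σ / Real.pi / (n - x) := by
      intro k hk
      rw [Finset.mem_Ico] at hk
      have h1 : k ≤ 2 * m - n - 1 := by omega
      have h2 : (k : ℝ) ≤ 2 * m - n - 1 := by exact_mod_cast h1
      have h3 : n - x ≤ x - k := by linarith
      rw [norm_cardTerm (by intro h; linarith), abs_of_pos (by linarith : 0 < x - k)]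
      exact div_le_div_of_nonneg_left (by positivity) (by linarith) h3
    refine (norm_sum_le_of_le _ hb).trans ?_
    rw [Finset.sum_const, Int.card_Ico, nsmul_eq_mul]
    have h4 : ((m - J - -(n : ℤ)).toNat : ℤ) = 2 * m := by omega
    have h5 : (((m - J - -(n : ℤ)).toNat : ℕ) : ℝ) = 2 * m := by exact_mod_cast h4
    rw [h5]
    have h6 : 0 ≤ σ / Real.pi / (n - x) := by
      have : 0 < n - x := by linarith
      positivity
    calc (2 * (m : ℝ)) * (σ / Real.pi / (n - x)) ≤ (2 * (x + 1 / 2)) * (σ / Real.pi / (n - x)) := by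
          gcongr; linarith
      _ = _ := by ring
  have hpair : ∀ j ∈ Finset.range J, ∃ R : ℂ, ‖R‖ ≤ 1 / (((j : ℝ) + 1) ^ 2 - 1 / 4) ∧
      cardTerm x θ (m + (j + 1)) + cardTerm x θ (m - (j + 1)) =
        (Real.sin (Real.pi * x) / Real.pi : ℝ) * Complex.exp (Complex.I * m * (θ + Real.pi : ℝ)) *
        (-(2 * Complex.I) * ((Real.sin ((j + 1) * (θ + Real.pi)) / (j + 1) : ℝ) : ℂ) + R) := by
    intro j _
    obtain ⟨R, hR, hE⟩ := exists_pair_eq (x - m) (θ + Real.pi) hd j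
    refine ⟨R, hR, ?_⟩
    have hj : (1 : ℝ) ≤ j + 1 := by linarith [j.cast_nonneg (α := ℝ)]
    rw [← hE, cardTerm_eq, cardTerm_eq, ← mul_add]
    · have e1 : Complex.exp (Complex.I * ((m + (j + 1) : ℤ) : ℂ) * (θ + Real.pi : ℝ)) =
          Complex.exp (Complex.I * m * (θ + Real.pi : ℝ)) *
            Complex.exp (Complex.I * ((j : ℂ) + 1) * (θ + Real.pi : ℝ)) := by
        rw [← Complex.exp_add]; push_cast; ring_nf
      have e2 : Complex.exp (Complex.I * ((m - (j + 1) : ℤ) : ℂ) * (θ + Real.pi : ℝ)) =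
          Complex.exp (Complex.I * m * (θ + Real.pi : ℝ)) *
            Complex.exp (-(Complex.I * ((j : ℂ) + 1) * (θ + Real.pi : ℝ))) := by
        rw [← Complex.exp_add]; push_cast; ring_nf
      have e3 : x - ((m + (j + 1) : ℤ) : ℝ) = x - m - (j + 1) := by push_cast; ring
      have e4 : x - ((m - (j + 1) : ℤ) : ℝ) = x - m + (j + 1) := by push_cast; ring
      rw [e1, e2, e3, e4]
      ring
    · intro h
      rw [h] at hd'
      push_cast at hd'
      linarith
    · intro h
      rw [h] at hd'
      push_cast at hd'
      linarith
  choose! R hR hE using hpair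
  have hmid : ‖∑ k ∈ Finset.Icc (m - J) (m + J), cardTerm x θ k‖ ≤
      1 + 2 * σ / Real.pi * (1 + sineIntegral Real.pi) := by
    rw [sum_Icc_sub_add, Finset.sum_congr rfl hE, ← Finset.mul_sum, Finset.sum_add_distrib,
      ← Finset.mul_sum, ← Complex.ofReal_sum]
    refine (norm_add_le _ _).trans (add_le_add (norm_cardTerm_le_one _ _ _) ?_)
    rw [norm_mul, norm_mul, norm_exp_I_mul_int_mul, Complex.norm_real, Real.norm_eq_abs, abs_div,
      abs_of_pos hπ, mul_one, ← hσ]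
    have h1 : ‖∑ j ∈ Finset.range J, R j‖ ≤ 2 :=
      (norm_sum_le_of_le _ hR).trans (sum_one_div_sq_sub_quarter_le J)
    have h2 := abs_sinSum_le J (θ + Real.pi)
    have h3 : ‖-(2 * Complex.I) * ((∑ j ∈ Finset.range J,
        Real.sin ((j + 1) * (θ + Real.pi)) / (j + 1) : ℝ) : ℂ)‖ ≤ 2 * sineIntegral Real.pi := by
      rw [norm_mul, norm_neg, norm_mul, Complex.norm_I, mul_one, Complex.norm_real,
        Complex.norm_ofNat]
      exact mul_le_mul_of_nonneg_left h2 zero_le_two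
    calc _ ≤ σ / Real.pi * (2 * sineIntegral Real.pi + 2) := by
          refine mul_le_mul_of_nonneg_left ?_ (by positivity)
          exact (norm_add_le _ _).trans (add_le_add h3 h1)
      _ = _ := by ring
  rw [hsplit]
  refine (norm_add_le _ _).trans ?_
  calc _ ≤ 2 * σ / Real.pi * ((x + 1 / 2) / (n - x)) +
        (1 + 2 * σ / Real.pi * (1 + sineIntegral Real.pi)) := add_le_add hleft hmid
    _ = _ := by ring

/-! ### Truncation error of the cardinal series inside the band. -/

theorem integral_exp_I_mul (a : ℝ) :
    ∫ u in (-Real.pi)..Real.pi, Complex.exp (Complex.I * a * u) =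
      2 * Real.pi * (Real.sinc (Real.pi * a) : ℂ) := by
  rcases eq_or_ne a 0 with rfl | ha
  · simp [two_mul]
  · have hc : Complex.I * a ≠ 0 := mul_ne_zero Complex.I_ne_zero (by exact_mod_cast ha)
    have hac : (a : ℂ) ≠ 0 := by exact_mod_cast ha
    have hpi : (Real.pi : ℂ) ≠ 0 := by exact_mod_cast Real.pi_ne_zero
    rw [integral_exp_mul_complex hc, Real.sinc_of_ne_zero (mul_ne_zero Real.pi_ne_zero ha),
      Complex.ofReal_div, Complex.ofReal_sin, Complex.sin]
    push_cast
    rw [show Complex.I * a * -Real.pi = -(Real.pi * a) * Complex.I by ring,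
      show Complex.I * a * Real.pi = (Real.pi * a) * Complex.I by ring]
    field_simp
    rw [Complex.I_sq]
    ring

/-- The function `exp (i x u) (1 + exp (i u))`, which vanishes at `u = ± π`. -/
def expFactor (x u : ℝ) : ℂ :=
  Complex.exp (Complex.I * x * u) * (1 + Complex.exp (Complex.I * u))

theorem exp_I_mul_pi : Complex.exp (Complex.I * Real.pi) = -1 := by
  rw [mul_comm, Complex.exp_pi_mul_I]

theorem exp_I_mul_neg_pi : Complex.exp (Complex.I * (-Real.pi : ℝ)) = -1 := by
  rw [Complex.ofReal_neg, mul_neg, Complex.exp_neg, exp_I_mul_pi]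
  norm_num

theorem continuous_expFactor (x : ℝ) : Continuous (expFactor x) := by
  unfold expFactor
  fun_prop

instance fact_two_pi_pos : Fact (0 < 2 * Real.pi) := ⟨Real.two_pi_pos⟩

theorem fourierCoeff_expFactor (x : ℝ) (k : ℤ) :
    fourierCoeff (AddCircle.liftIco (2 * Real.pi) (-Real.pi) (expFactor x)) k =
      (Real.sinc (Real.pi * (x - k)) : ℂ) + (Real.sinc (Real.pi * (x - (k - 1 : ℤ))) : ℂ) := by
  rw [fourierCoeff_liftIco_eq, fourierCoeffOn_eq_integral,
    show -Real.pi + 2 * Real.pi = Real.pi by ring]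
  have hpi : (Real.pi : ℂ) ≠ 0 := by exact_mod_cast Real.pi_ne_zero
  have e : ∀ u : ℝ, (fourier (-k) (u : AddCircle (Real.pi - -Real.pi)) : ℂ) • expFactor x u =
      Complex.exp (Complex.I * (x - k : ℝ) * u) +
        Complex.exp (Complex.I * (x - (k - 1 : ℤ) : ℝ) * u) := by
    intro u
    rw [fourier_coe_apply, smul_eq_mul, expFactor, mul_add, mul_add, mul_one, ← Complex.exp_add,
      ← Complex.exp_add, ← Complex.exp_add]
    have h2 : 2 * (Real.pi : ℂ) * Complex.I * ((-k : ℤ) : ℂ) * u / ((Real.pi - -Real.pi : ℝ) : ℂ) =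
        -(Complex.I * k * u) := by
      push_cast
      field_simp
      ring
    rw [h2]
    congr 2 <;> push_cast <;> ring
  simp_rw [e]
  rw [intervalIntegral.integral_add
    (Continuous.intervalIntegrable (by fun_prop) _ _)
    (Continuous.intervalIntegrable (by fun_prop) _ _), integral_exp_I_mul, integral_exp_I_mul,
    Complex.real_smul]
  push_cast
  field_simp
  ring

/-- A single `sinc` decays only like `1/|k|`. Neighbouring values have opposite signs, so the sum is
a multiple of `1/((x - k)(x - k + 1))`, which is dominated by the sum of the two inverse squares. -/
theorem summable_sinc_add (x : ℝ) :
    Summable fun k : ℤ =>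
      (Real.sinc (Real.pi * (x - k)) : ℂ) + (Real.sinc (Real.pi * (x - (k - 1 : ℤ))) : ℂ) := by
  have h := (Real.summable_one_div_int_add_rpow (-x) 2).2 one_lt_two
  have h' := (Real.summable_one_div_int_add_rpow (-x - 1) 2).2 one_lt_two
  refine Summable.of_norm_bounded_eventually (h.add h') ?_
  have hfin : {k : ℤ | x = k ∨ x = (k - 1 : ℤ)}.Finite := by
    refine (Set.toFinite ({⌊x⌋, ⌊x⌋ + 1} : Set ℤ)).subset ?_
    rintro k (hk | hk)
    · left; rw [hk, Int.floor_intCast]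
    · right
      rw [Set.mem_singleton_iff, hk, Int.floor_intCast]; ring
  filter_upwards [hfin.compl_mem_cofinite] with k hk
  simp only [Set.mem_compl_iff, Set.mem_ofPred_eq, not_or] at hk
  have h1 := sub_ne_zero.2 hk.1
  have h2 := sub_ne_zero.2 hk.2
  have hp := Real.pi_pos
  rw [sinc_pi_mul_sub_int hk.1, sinc_pi_mul_sub_int hk.2, ← Complex.ofReal_add, Complex.norm_real,
    Real.norm_eq_abs]
  have e : (-1 : ℝ) ^ k * Real.sin (Real.pi * x) / (Real.pi * (x - k)) +
      (-1) ^ (k - 1) * Real.sin (Real.pi * x) / (Real.pi * (x - (k - 1 : ℤ))) =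
      (-1) ^ k * Real.sin (Real.pi * x) / Real.pi * (1 / ((x - k) * (x - (k - 1 : ℤ)))) := by
    rw [zpow_sub_one₀ (by norm_num : (-1 : ℝ) ≠ 0)]
    push_cast at h2 ⊢
    have h3 : x - (k - 1) ≠ 0 := h2
    field_simp
    ring
  rw [e, abs_mul]
  have l1 : |(-1 : ℝ) ^ k * Real.sin (Real.pi * x) / Real.pi| ≤ 1 := by
    rw [abs_div, abs_mul, abs_zpow, abs_neg, abs_one, one_zpow, one_mul, abs_of_pos hp]
    rw [div_le_one hp]
    have := Real.abs_sin_le_one (Real.pi * x)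
    linarith [Real.pi_gt_three]
  refine (mul_le_of_le_one_left (abs_nonneg _) l1).trans ?_
  rw [show (2 : ℝ) = (2 : ℕ) by norm_num, Real.rpow_natCast, Real.rpow_natCast, sq_abs, sq_abs,
    abs_div, abs_one, abs_mul]
  have e1 : (k : ℝ) + -x = -(x - k) := by ring
  have e2 : (k : ℝ) + (-x - 1) = -(x - (k - 1 : ℤ)) := by push_cast; ring
  rw [e1, e2, neg_sq, neg_sq, ← sq_abs (x - k), ← sq_abs (x - (k - 1 : ℤ))]
  have a1 := abs_pos.2 h1
  have a2 := abs_pos.2 h2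
  generalize |x - (k : ℝ)| = a at a1 ⊢
  generalize |x - ((k - 1 : ℤ) : ℝ)| = b at a2 ⊢
  rw [div_add_div _ _ (by positivity) (by positivity), div_le_div_iff₀ (by positivity)
    (by positivity)]
  nlinarith [sq_nonneg (a - b), mul_pos a1 a2, mul_nonneg (mul_pos a1 a2).le (sq_nonneg (a - b)),
    mul_pos (mul_pos a1 a2) (mul_pos a1 a2)]

/-- `expFactor` takes equal values at `±π`, hence is continuous on the circle; its Fourier
coefficients are summable, so its Fourier series converges to it pointwise. -/
theorem hasSum_cardTerm_add (x : ℝ) {θ : ℝ} (hθ : θ ∈ Set.Ico (-Real.pi) Real.pi) :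
    HasSum (fun k : ℤ => cardTerm x θ k + Complex.exp (Complex.I * θ) * cardTerm x θ (k - 1))
      (expFactor x θ) := by
  have h0 : expFactor x (-Real.pi) = expFactor x (-Real.pi + 2 * Real.pi) := by
    rw [show -Real.pi + 2 * Real.pi = Real.pi by ring, expFactor, expFactor, exp_I_mul_neg_pi,
      exp_I_mul_pi]
    simp
  have hc := AddCircle.liftIco_continuous h0 (continuous_expFactor x).continuousOn
  let G : C(AddCircle (2 * Real.pi), ℂ) := ⟨_, hc⟩
  have hG : ∀ k, fourierCoeff G k =
      (Real.sinc (Real.pi * (x - k)) : ℂ) + (Real.sinc (Real.pi * (x - (k - 1 : ℤ))) : ℂ) :=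
    fourierCoeff_expFactor x
  have hs : Summable (fourierCoeff G) := by
    rw [funext hG]; exact summable_sinc_add x
  have h := has_pointwise_sum_fourier_series_of_summable hs (θ : AddCircle (2 * Real.pi))
  have hv : G (θ : AddCircle (2 * Real.pi)) = expFactor x θ :=
    AddCircle.liftIco_coe_apply (f := expFactor x)
      (show θ ∈ Set.Ico (-Real.pi) (-Real.pi + 2 * Real.pi) from ⟨hθ.1, by linarith [hθ.2]⟩)
  rw [hv] at h
  refine h.congr_fun fun k => ?_
  have hpi : (Real.pi : ℂ) ≠ 0 := by exact_mod_cast Real.pi_ne_zero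
  rw [hG, fourier_coe_apply, smul_eq_mul, cardTerm, cardTerm]
  have e1 : 2 * (Real.pi : ℂ) * Complex.I * k * θ / ((2 * Real.pi : ℝ) : ℂ) =
      Complex.I * k * θ := by
    push_cast
    field_simp
  have e2 : Complex.exp (Complex.I * k * θ) =
      Complex.exp (Complex.I * θ) * Complex.exp (Complex.I * ((k - 1 : ℤ) : ℂ) * θ) := by
    rw [← Complex.exp_add]; push_cast; ring_nf
  rw [e1, add_mul, mul_left_comm, ← e2]

/-- The factor `e^{iθ}` aligns the phases of adjacent terms up to a sign, leaving a difference of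
reciprocals that telescopes in `k`. -/
theorem norm_cardTerm_add {x θ : ℝ} {k : ℤ} (h : x ≠ k) (h' : x ≠ (k - 1 : ℤ)) :
    ‖cardTerm x θ k + Complex.exp (Complex.I * θ) * cardTerm x θ (k - 1)‖ =
      |Real.sin (Real.pi * x)| / Real.pi * |1 / (x - k) - 1 / (x - k + 1)| := by
  have e : Complex.exp (Complex.I * θ) *
      Complex.exp (Complex.I * ((k - 1 : ℤ) : ℂ) * (θ + Real.pi : ℝ)) =
      -Complex.exp (Complex.I * k * (θ + Real.pi : ℝ)) := by
    have : Complex.I * k * (θ + Real.pi : ℝ) = (Complex.I * θ +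
      Complex.I * ((k - 1 : ℤ) : ℂ) * (θ + Real.pi : ℝ)) + Complex.I * Real.pi := by
      push_cast; ring
    rw [this, Complex.exp_add _ (Complex.I * Real.pi), exp_I_mul_pi, Complex.exp_add]
    ring
  have e2 : cardTerm x θ k + Complex.exp (Complex.I * θ) * cardTerm x θ (k - 1) =
      (Real.sin (Real.pi * x) / Real.pi : ℝ) * Complex.exp (Complex.I * k * (θ + Real.pi : ℝ)) *
        ((1 / (x - k) - 1 / (x - k + 1) : ℝ) : ℂ) := by
    rw [cardTerm_eq h, cardTerm_eq h', mul_left_comm, ← mul_div_assoc (Complex.exp _), e,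
      show x - ((k - 1 : ℤ) : ℝ) = x - k + 1 by push_cast; ring]
    push_cast
    ring
  rw [e2, norm_mul, norm_mul, norm_exp_I_mul_int_mul, Complex.norm_real, Complex.norm_real,
    Real.norm_eq_abs, Real.norm_eq_abs, abs_div, abs_of_pos Real.pi_pos, mul_one]

/-- Summation by parts: the original partial sum reappears with the factor `1 + e^{iθ}`, plus two
boundary terms just outside the window. -/
theorem sum_Icc_cardTerm_add (x θ : ℝ) (N : ℕ) :
    ∑ k ∈ Finset.Icc (-(N : ℤ)) (N + 1),
        (cardTerm x θ k + Complex.exp (Complex.I * θ) * cardTerm x θ (k - 1)) =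
      (1 + Complex.exp (Complex.I * θ)) * ∑ k ∈ Finset.Icc (-(N : ℤ)) N, cardTerm x θ k +
        (cardTerm x θ (N + 1) + Complex.exp (Complex.I * θ) * cardTerm x θ (-N - 1)) := by
  have e1 : ∑ k ∈ Finset.Icc (-(N : ℤ)) (N + 1), cardTerm x θ k =
      ∑ k ∈ Finset.Icc (-(N : ℤ)) N, cardTerm x θ k + cardTerm x θ (N + 1) := by
    rw [show Finset.Icc (-(N : ℤ)) (N + 1) = insert ((N : ℤ) + 1) (Finset.Icc (-(N : ℤ)) N) by
      ext k; simp only [Finset.mem_insert, Finset.mem_Icc]; omega, Finset.sum_insert, add_comm]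
    simp
  have e2 : ∑ k ∈ Finset.Icc (-(N : ℤ)) (N + 1), cardTerm x θ (k - 1) =
      ∑ k ∈ Finset.Icc (-(N : ℤ)) N, cardTerm x θ k + cardTerm x θ (-N - 1) := by
    have : ∑ k ∈ Finset.Icc (-(N : ℤ)) (N + 1), cardTerm x θ (k - 1) =
        ∑ k ∈ Finset.Icc (-(N : ℤ) - 1) N, cardTerm x θ k := by
      refine Finset.sum_bij (fun k _ => k - 1) ?_ ?_ ?_ ?_
      · intro k hk; simp only [Finset.mem_Icc] at hk ⊢; omega
      · intro a _ b _ h; omega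
      · intro b hb
        simp only [Finset.mem_Icc] at hb
        exact ⟨b + 1, by simp only [Finset.mem_Icc]; omega, by ring⟩
      · intro k _; rfl
    rw [this, show Finset.Icc (-(N : ℤ) - 1) N = insert (-(N : ℤ) - 1) (Finset.Icc (-(N : ℤ)) N) by
      ext k; simp only [Finset.mem_insert, Finset.mem_Icc]; omega, Finset.sum_insert, add_comm]
    simp
  rw [Finset.sum_add_distrib, ← Finset.mul_sum, e1, e2]
  ring

/-- The tail of the differenced cardinal series is bounded by its telescoping majorant. -/
theorem norm_expFactor_sub_sum_le {x θ : ℝ} (n : ℕ) (hx : 0 ≤ x) (hxn : x < n)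
    (hθ : θ ∈ Set.Ico (-Real.pi) Real.pi) :
    ‖expFactor x θ - ∑ k ∈ Finset.Icc (-(n : ℤ)) (n + 1),
        (cardTerm x θ k + Complex.exp (Complex.I * θ) * cardTerm x θ (k - 1))‖ ≤
      |Real.sin (Real.pi * x)| / Real.pi * (1 / (n + 1 - x) + 1 / (n + 1 + x)) := by
  set t : ℤ → ℂ := fun k =>
    cardTerm x θ k + Complex.exp (Complex.I * θ) * cardTerm x θ (k - 1) with ht
  set σ := |Real.sin (Real.pi * x)| / Real.pi with hσ
  have hσ0 : 0 ≤ σ := div_nonneg (abs_nonneg _) Real.pi_pos.le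
  set b : ℕ → ℝ := fun N => σ * (1 / (N + n + 1 - x) + 1 / (N + n + 1 + x)) with hb
  set R : ℕ → ℂ := fun N =>
    expFactor x θ - ∑ k ∈ Finset.Icc (-((N + n : ℕ) : ℤ)) ((N + n : ℕ) + 1), t k with hR
  -- Comparing one step at a time avoids summing the tail: `‖R N‖ - b N` increases to the limit `0`,
  -- so it is nonpositive at `N = 0`.
  have hRb : Monotone fun N => ‖R N‖ - b N := by
    refine monotone_nat_of_le_succ fun N => ?_
    have hN : (0 : ℝ) ≤ N := N.cast_nonneg
    have e : R N = R (N + 1) + (t ((N + n : ℕ) + 2) + t (-(N + n : ℕ) - 1)) := by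
      simp only [hR]
      rw [show Finset.Icc (-((N + 1 + n : ℕ) : ℤ)) ((N + 1 + n : ℕ) + 1) =
        insert (((N + n : ℕ) : ℤ) + 2) (insert (-((N + n : ℕ) : ℤ) - 1)
          (Finset.Icc (-((N + n : ℕ) : ℤ)) ((N + n : ℕ) + 1))) by
        ext k; simp only [Finset.mem_insert, Finset.mem_Icc]; push_cast; omega,
        Finset.sum_insert, Finset.sum_insert]
      · ring
      · simp only [Finset.mem_Icc]; omega
      · simp only [Finset.mem_insert, Finset.mem_Icc]; omega
    have h1 : ‖t ((N + n : ℕ) + 2)‖ = σ * (1 / (N + n + 1 - x) - 1 / (N + n + 2 - x)) := by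
      have q1 : (0 : ℝ) < N + n + 1 - x := by linarith
      have q2 : (0 : ℝ) < N + n + 2 - x := by linarith
      rw [ht, norm_cardTerm_add (by push_cast; intro h; linarith)
        (by push_cast; intro h; linarith), ← hσ]
      congr 1
      push_cast
      rw [show x - ((N : ℝ) + n + 2) + 1 = -(N + n + 1 - x) by ring,
        show x - ((N : ℝ) + n + 2) = -(N + n + 2 - x) by ring, one_div_neg_eq_neg_one_div,
        one_div_neg_eq_neg_one_div, abs_of_nonneg]
      · ring
      · have := one_div_le_one_div_of_le q1 (by linarith : (N : ℝ) + n + 1 - x ≤ N + n + 2 - x)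
        linarith
    have h2 : ‖t (-(N + n : ℕ) - 1)‖ = σ * (1 / (N + n + 1 + x) - 1 / (N + n + 2 + x)) := by
      have q1 : (0 : ℝ) < N + n + 1 + x := by linarith
      rw [ht, norm_cardTerm_add (by push_cast; intro h; linarith)
        (by push_cast; intro h; linarith), ← hσ]
      congr 1
      push_cast
      rw [show x - (-((N : ℝ) + n) - 1) + 1 = N + n + 2 + x by ring,
        show x - (-((N : ℝ) + n) - 1) = N + n + 1 + x by ring, abs_of_nonneg]
      have := one_div_le_one_div_of_le q1 (by linarith : (N : ℝ) + n + 1 + x ≤ N + n + 2 + x)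
      linarith
    have h3 : ‖R N‖ ≤ ‖R (N + 1)‖ + (‖t ((N + n : ℕ) + 2)‖ + ‖t (-(N + n : ℕ) - 1)‖) := by
      rw [e]
      exact (norm_add_le _ _).trans (add_le_add_right (norm_add_le _ _) _)
    rw [h1, h2] at h3
    simp only [hb]
    push_cast
    rw [show (N : ℝ) + 1 + n + 1 - x = N + n + 2 - x by ring,
      show (N : ℝ) + 1 + n + 1 + x = N + n + 2 + x by ring]
    linarith
  have hlim : Tendsto (fun N => ‖R N‖ - b N) atTop (𝓝 (0 - σ * (0 + 0))) := by
    refine Tendsto.sub ?_ (Tendsto.const_mul _ (Tendsto.add ?_ ?_))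
    · have hfin : Tendsto (fun N : ℕ =>
          Finset.Icc (-((N + n : ℕ) : ℤ)) ((N + n : ℕ) + 1)) atTop atTop := by
        refine tendsto_atTop_finset_of_monotone (fun a b hab => ?_) fun k => ?_
        · intro k; simp only [Finset.mem_Icc]; push_cast; omega
        · exact ⟨k.natAbs, by simp only [Finset.mem_Icc, Nat.cast_add, Int.natCast_natAbs]; grind⟩
      have h := (hasSum_cardTerm_add x hθ).comp hfin
      have h2 := (h.const_sub (expFactor x θ)).norm
      rw [sub_self, norm_zero] at h2
      exact h2
    · have : Tendsto (fun N : ℕ => (N : ℝ) + (n + 1 - x)) atTop atTop :=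
        tendsto_atTop_add_const_right _ _ tendsto_natCast_atTop_atTop
      refine this.inv_tendsto_atTop.congr fun N => ?_
      rw [Pi.inv_apply, ← one_div]
      ring_nf
    · have : Tendsto (fun N : ℕ => (N : ℝ) + (n + 1 + x)) atTop atTop :=
        tendsto_atTop_add_const_right _ _ tendsto_natCast_atTop_atTop
      refine this.inv_tendsto_atTop.congr fun N => ?_
      rw [Pi.inv_apply, ← one_div]
      ring_nf
  have h := hRb.ge_of_tendsto hlim 0
  simp only [hR, hb, add_zero, mul_zero, sub_zero, Nat.cast_zero, zero_add] at h
  linarith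

/-- The modulus is `2 cos (θ/2)`, and the cosine lies above its chord on `[0, π/2]`. -/
theorem two_mul_one_sub_le_norm {θ : ℝ} (hθ : |θ| ≤ Real.pi) :
    2 * (1 - |θ| / Real.pi) ≤ ‖1 + Complex.exp (Complex.I * θ)‖ := by
  have h1 : 1 + Complex.exp (Complex.I * θ) =
      Complex.exp (((θ / 2 : ℝ) : ℂ) * Complex.I) * ((2 * Real.cos (θ / 2) : ℝ) : ℂ) := by
    push_cast
    rw [Complex.two_cos, mul_add, ← Complex.exp_add, ← Complex.exp_add]
    ring_nf
    simp [add_comm]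
  rw [h1, norm_mul, Complex.norm_exp_ofReal_mul_I, one_mul, Complex.norm_real, Real.norm_eq_abs]
  refine le_trans ?_ (le_abs_self _)
  have h2 := Real.one_sub_mul_le_cos (x := |θ / 2|) (abs_nonneg _)
    (by rw [abs_div, abs_two]; linarith)
  rw [Real.cos_abs, abs_div, abs_two] at h2
  calc 2 * (1 - |θ| / Real.pi) = 2 * (1 - 2 / Real.pi * (|θ| / 2)) := by ring
    _ ≤ _ := by linarith

/-- The truncation error of the cardinal series of `exp (i x θ)` inside the band. -/
theorem norm_exp_sub_sum_cardTerm_le {x θ : ℝ} (n : ℕ) (hx : 0 ≤ x) (hxn : x < n)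
    (hθ : |θ| < Real.pi) :
    ‖Complex.exp (Complex.I * x * θ) - ∑ k ∈ Finset.Icc (-(n : ℤ)) n, cardTerm x θ k‖ ≤
      1 / Real.pi * (1 / (n + 1 - x) + 1 / (n + 1 + x)) / (1 - |θ| / Real.pi) := by
  have hθ' := abs_lt.1 hθ
  have hp := Real.pi_pos
  have hR := norm_expFactor_sub_sum_le n hx hxn ⟨hθ'.1.le, hθ'.2⟩
  rw [sum_Icc_cardTerm_add] at hR
  set σ := |Real.sin (Real.pi * x)| / Real.pi with hσ
  have hσ1 : σ ≤ 1 / Real.pi := div_le_div_of_nonneg_right (Real.abs_sin_le_one _) hp.le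
  set q := 1 / ((n : ℝ) + 1 - x) + 1 / (n + 1 + x) with hq
  have hq0 : 0 ≤ q := by
    have : (0 : ℝ) < n + 1 - x := by linarith
    have : (0 : ℝ) < n + 1 + x := by linarith
    positivity
  have hden : 0 < 1 - |θ| / Real.pi := by
    have := (div_lt_one hp).2 hθ
    linarith
  set E := Complex.exp (Complex.I * x * θ) - ∑ k ∈ Finset.Icc (-(n : ℤ)) n, cardTerm x θ k with hE
  -- The boundary terms obey the same bound `σ q` as the tail; the resulting `2 σ q` cancels against
  -- the factor `2` in the lower bound for `‖1 + e^{iθ}‖`.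
  set u := cardTerm x θ (n + 1) + Complex.exp (Complex.I * θ) * cardTerm x θ (-n - 1) with hu
  have hun : ‖u‖ ≤ σ * q := by
    refine (norm_add_le _ _).trans ?_
    have hexp : ‖Complex.exp (Complex.I * θ)‖ = 1 := by
      rw [mul_comm, Complex.norm_exp_ofReal_mul_I]
    rw [norm_mul, hexp, one_mul, norm_cardTerm (by push_cast; intro h; linarith),
      norm_cardTerm (by push_cast; intro h; linarith), ← hσ]
    push_cast
    rw [abs_of_neg (by linarith), abs_of_pos (by linarith), hq]
    refine le_of_eq ?_
    rw [show -(x - ((n : ℝ) + 1)) = n + 1 - x by ring,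
      show x - (-(n : ℝ) - 1) = n + 1 + x by ring]
    ring
  have hmain : (1 + Complex.exp (Complex.I * θ)) * E = (expFactor x θ -
      ((1 + Complex.exp (Complex.I * θ)) * ∑ k ∈ Finset.Icc (-(n : ℤ)) n, cardTerm x θ k + u)) +
      u := by
    rw [expFactor, hE]
    ring
  have h1 : ‖1 + Complex.exp (Complex.I * θ)‖ * ‖E‖ ≤ σ * q + σ * q := by
    rw [← norm_mul, hmain]
    exact (norm_add_le _ _).trans (add_le_add hR hun)
  have h2 : 2 * (1 - |θ| / Real.pi) * ‖E‖ ≤ σ * q + σ * q :=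
    (mul_le_mul_of_nonneg_right (two_mul_one_sub_le_norm hθ.le) (norm_nonneg _)).trans h1
  rw [le_div_iff₀ hden]
  have h3 : σ * q ≤ 1 / Real.pi * q := mul_le_mul_of_nonneg_right hσ1 hq0
  linarith

/-! ### Spectral isometry for the sampling error. -/

section SecondMoment

/-- The time points entering the sampling error: `t` itself, then the sampling points. -/
def errNode (w : ℝ) (n : ℕ) (t : ℝ) : ℕ → ℝ
  | 0 => t
  | j + 1 => ((j - n : ℤ) : ℝ) * Real.pi / w

/-- The coefficients of the sampling error `X(t) - X_n(t)` at the points `errNode`. -/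
def errCoef (w : ℝ) (n : ℕ) (t : ℝ) : ℕ → ℝ
  | 0 => 1
  | j + 1 => -Real.sinc (w * (t - ((j - n : ℤ) : ℝ) * Real.pi / w))

theorem sum_range_sub_eq_sum_Icc {M : Type*} [AddCommMonoid M] (h : ℤ → M) (n : ℕ) :
    ∑ j ∈ Finset.range (2 * n + 1), h (j - n) = ∑ k ∈ Finset.Icc (-(n : ℤ)) n, h k := by
  refine Finset.sum_bij (fun j _ => (j : ℤ) - n) ?_ ?_ ?_ ?_
  · intro j hj; simp only [Finset.mem_range, Finset.mem_Icc] at hj ⊢; omega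
  · intro a _ b _ hab; omega
  · intro k hk
    simp only [Finset.mem_Icc] at hk
    exact ⟨(k + n).toNat, by simp only [Finset.mem_range]; omega, by omega⟩
  · intro j _; rfl

theorem sub_truncSum_eq {Ω : Type*} (X : ℝ → Ω → ℝ) (w : ℝ) (n : ℕ) (t : ℝ) (ω : Ω) :
    X t ω - truncSum w n X t ω =
      ∑ j ∈ Finset.range (2 * n + 1 + 1), errCoef w n t j * X (errNode w n t j) ω := by
  rw [Finset.sum_range_succ', truncSum, ← sum_range_sub_eq_sum_Icc]
  simp only [errCoef, errNode, neg_mul, Finset.sum_neg_distrib, one_mul]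
  ring

variable {Ω : Type*} [MeasurableSpace Ω]

theorem covFun_eq_integral_cos {P : Measure Ω} {X : ℝ → Ω → ℝ} {F : Measure ℝ}
    (hF : IsSpectralMeasure P X F) (τ : ℝ) : covFun P X τ = ∫ x, Real.cos (τ * x) ∂F := by
  have := hF.finite
  have e : ∀ x : ℝ, Complex.exp (Complex.I * τ * x) = Complex.exp ((τ * x : ℝ) * Complex.I) := by
    intro x; push_cast; ring_nf
  have hi : Integrable (fun x : ℝ => Complex.exp (Complex.I * τ * x)) F := by
    refine (integrable_const (1 : ℝ)).mono' (by fun_prop) (ae_of_all _ fun x => ?_)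
    rw [e, Complex.norm_exp_ofReal_mul_I]
  have h := congrArg Complex.re (hF.cov_eq τ)
  rw [Complex.ofReal_re] at h
  rw [h, ← Complex.reCLM_apply, ← ContinuousLinearMap.integral_comp_comm _ hi]
  congr 1
  ext x
  rw [Complex.reCLM_apply, e, Complex.exp_ofReal_mul_I_re]

theorem integral_mul_eq_covFun {P : Measure Ω} {X : ℝ → Ω → ℝ} (hX : IsStationary P X)
    (s t : ℝ) : ∫ ω, X s ω * X t ω ∂P = covFun P X (s - t) := by
  rw [← hX.cov_eq t (s - t), add_sub_cancel]

theorem norm_sq_sum_exp {ι : Type*} (s : Finset ι) (a τ : ι → ℝ) (x : ℝ) :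
    ‖∑ i ∈ s, (a i : ℂ) * Complex.exp (Complex.I * τ i * x)‖ ^ 2 =
      ∑ i ∈ s, ∑ j ∈ s, a i * a j * Real.cos ((τ i - τ j) * x) := by
  have e : ∀ i, Complex.exp (Complex.I * τ i * x) =
      Complex.exp ((τ i * x : ℝ) * Complex.I) := by
    intro i; push_cast; ring_nf
  rw [Complex.sq_norm, Complex.normSq_apply, Complex.re_sum, Complex.im_sum]
  simp only [e, Complex.re_ofReal_mul, Complex.im_ofReal_mul, Complex.exp_ofReal_mul_I_re,
    Complex.exp_ofReal_mul_I_im]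
  rw [Finset.sum_mul_sum, Finset.sum_mul_sum, ← Finset.sum_add_distrib]
  refine Finset.sum_congr rfl fun i _ => ?_
  rw [← Finset.sum_add_distrib]
  refine Finset.sum_congr rfl fun j _ => ?_
  rw [sub_mul, Real.cos_sub]
  ring

/-- The spectral isometry on finite linear combinations. -/
theorem integral_sq_sum_eq {P : Measure Ω} {X : ℝ → Ω → ℝ} (hX : IsStationary P X)
    {F : Measure ℝ} (hF : IsSpectralMeasure P X F) {ι : Type*} (s : Finset ι) (a τ : ι → ℝ) :
    ∫ ω, (∑ i ∈ s, a i * X (τ i) ω) ^ 2 ∂P =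
      ∫ x : ℝ, ‖∑ i ∈ s, (a i : ℂ) * Complex.exp (Complex.I * τ i * x)‖ ^ 2 ∂F := by
  have := hF.finite
  have hint : ∀ i j, Integrable (fun ω => X (τ i) ω * X (τ j) ω) P := fun i j =>
    (hX.memLp (τ i)).integrable_mul (hX.memLp (τ j))
  have hcos : ∀ c : ℝ, Integrable (fun x => Real.cos (c * x)) F := fun c =>
    (integrable_const (1 : ℝ)).mono' (by fun_prop)
      (ae_of_all _ fun x => Real.abs_cos_le_one _)
  simp_rw [norm_sq_sum_exp]
  have e : ∀ ω, (∑ i ∈ s, a i * X (τ i) ω) ^ 2 =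
      ∑ i ∈ s, ∑ j ∈ s, a i * a j * (X (τ i) ω * X (τ j) ω) := by
    intro ω
    rw [sq, Finset.sum_mul_sum]
    refine Finset.sum_congr rfl fun i _ => Finset.sum_congr rfl fun j _ => ?_
    ring
  simp_rw [e]
  rw [integral_finsetSum _ fun i _ => integrable_finsetSum _ fun j _ => (hint i j).const_mul _,
    integral_finsetSum _ fun i _ => integrable_finsetSum _ fun j _ => (hcos _).const_mul _]
  refine Finset.sum_congr rfl fun i _ => ?_
  rw [integral_finsetSum _ fun j _ => (hint i j).const_mul _,
    integral_finsetSum _ fun j _ => (hcos _).const_mul _]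
  refine Finset.sum_congr rfl fun j _ => ?_
  rw [integral_const_mul, integral_const_mul, integral_mul_eq_covFun hX,
    covFun_eq_integral_cos hF]

/-- Rescaling by `wt/π` and `πx/w` moves the sampling points to the integers and the band `|x| < w`
to `|θ| < π`. -/
theorem sum_errCoef_mul_exp {w : ℝ} (hw : 0 < w) (n : ℕ) (t x : ℝ) :
    ∑ j ∈ Finset.range (2 * n + 1 + 1),
        (errCoef w n t j : ℂ) * Complex.exp (Complex.I * errNode w n t j * x) =
      Complex.exp (Complex.I * (w * t / Real.pi : ℝ) * (Real.pi * x / w : ℝ)) -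
        ∑ k ∈ Finset.Icc (-(n : ℤ)) n, cardTerm (w * t / Real.pi) (Real.pi * x / w) k := by
  have hpi : (Real.pi : ℂ) ≠ 0 := by exact_mod_cast Real.pi_ne_zero
  have hpi' := Real.pi_ne_zero
  have hwc : (w : ℂ) ≠ 0 := by exact_mod_cast hw.ne'
  rw [Finset.sum_range_succ', ← sum_range_sub_eq_sum_Icc]
  simp only [errCoef, errNode, Complex.ofReal_neg, neg_mul, Finset.sum_neg_distrib,
    Complex.ofReal_one, one_mul]
  rw [add_comm, ← sub_eq_add_neg]
  congr 1
  · congr 1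
    push_cast
    field_simp
  · refine Finset.sum_congr rfl fun j _ => ?_
    rw [cardTerm]
    congr 2
    · congr 1
      field_simp
    · push_cast
      field_simp

end SecondMoment

/-! ### The mean square bound `A_n(t, Λ)`. -/

section Bounds

variable {w z Λ T t : ℝ} {n : ℕ}

theorem mul_div_pi_le_sqrt_mul (hw : 0 < w) (hz : 0 < z) (htT : t ≤ T)
    (hn : w * T / (Real.pi * √z) ≤ (n : ℝ)) : w * t / Real.pi ≤ √z * n := by
  have hp := Real.pi_pos
  have hs := Real.sqrt_pos.2 hz
  rw [div_le_iff₀ (by positivity)] at hn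
  rw [div_le_iff₀ hp]
  nlinarith [mul_le_mul_of_nonneg_left htT hw.le]

theorem kernel_bound_inside (hx : 0 ≤ t) (hw : 0 < w) (hΛw : Λ < w) (hz : 0 < z) (hz1 : z < 1)
    (hn0 : 0 < n) (hxn : w * t / Real.pi ≤ √z * n) {x : ℝ} (hxΛ : |x| ≤ Λ) :
    ‖∑ j ∈ Finset.range (2 * n + 1 + 1),
        (errCoef w n t j : ℂ) * Complex.exp (Complex.I * errNode w n t j * x)‖ ≤
      (4 * w * t / (Real.pi ^ 2 * (1 - z)) +
        4 * (z + 1 + 1 / (n : ℝ)) / (Real.pi * (1 - z) ^ 2 * (1 - Λ / w))) / n := by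
  have hp := Real.pi_pos
  have hn' : (0 : ℝ) < n := Nat.cast_pos.2 hn0
  have hz' : 0 < 1 - z := by linarith
  have hs1 : √z < 1 := by rw [Real.sqrt_lt' one_pos]; simpa using hz1
  have hL : 0 < 1 - Λ / w := by
    have := (div_lt_one hw).2 hΛw
    linarith
  rw [sum_errCoef_mul_exp hw]
  set y := w * t / Real.pi with hy
  have hy0 : 0 ≤ y := by positivity
  have hyn : y < n := hxn.trans_lt (by nlinarith)
  have hθ : |Real.pi * x / w| / Real.pi = |x| / w := by
    rw [abs_div, abs_mul, abs_of_pos hp, abs_of_pos hw]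
    field_simp
  have hxw : |x| / w ≤ Λ / w := div_le_div_of_nonneg_right hxΛ hw.le
  have hθ1 : |Real.pi * x / w| < Real.pi := by
    rw [← div_lt_one hp, hθ]
    linarith
  refine (norm_exp_sub_sum_cardTerm_le n hy0 hyn hθ1).trans ?_
  rw [hθ]
  have hyz : y ^ 2 ≤ z * n ^ 2 := by
    have := pow_le_pow_left₀ hy0 hxn 2
    rwa [mul_pow, Real.sq_sqrt hz.le] at this
  -- Here `y ≤ √z n` enters through `(n - y)(n + y) ≥ n² (1 - z)`.
  have h1 : 1 / ((n : ℝ) + 1 - y) + 1 / (n + 1 + y) ≤ 2 / (n * (1 - z)) := by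
    have q1 : 0 < (n : ℝ) - y := by linarith
    have q2 : 0 < (n : ℝ) + y := by linarith
    calc 1 / ((n : ℝ) + 1 - y) + 1 / (n + 1 + y) ≤ 1 / (n - y) + 1 / (n + y) :=
          add_le_add (one_div_le_one_div_of_le q1 (by linarith))
            (one_div_le_one_div_of_le q2 (by linarith))
      _ = 2 * n / ((n - y) * (n + y)) := by field_simp; ring
      _ ≤ 2 / (n * (1 - z)) := by
        rw [div_le_div_iff₀ (by positivity) (by positivity)]
        nlinarith
  have h2 : (z + 1 + 1 / (n : ℝ)) / (1 - z) ≥ 1 := by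
    rw [ge_iff_le, one_le_div hz']
    have : 0 < 1 / (n : ℝ) := by positivity
    linarith
  -- The estimate obtained is sharper than the stated constant: what follows doubles it, inserts the
  -- factor `h2`, which is at least `1`, and adds the nonnegative first summand.
  calc 1 / Real.pi * (1 / ((n : ℝ) + 1 - y) + 1 / (n + 1 + y)) / (1 - |x| / w)
      ≤ 1 / Real.pi * (2 / (n * (1 - z))) / (1 - Λ / w) := by
        apply div_le_div₀ (by positivity) _ hL (by linarith)
        exact mul_le_mul_of_nonneg_left h1 (by positivity)
    _ = (2 / (Real.pi * (1 - z) * (1 - Λ / w))) * 1 / n := by field_simp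
    _ ≤ (4 / (Real.pi * (1 - z) * (1 - Λ / w))) * ((z + 1 + 1 / (n : ℝ)) / (1 - z)) / n := by
        gcongr
        norm_num
    _ = (4 * (z + 1 + 1 / (n : ℝ)) / (Real.pi * (1 - z) ^ 2 * (1 - Λ / w))) / n := by
        field_simp
    _ ≤ _ := by
        gcongr
        have : 0 ≤ 4 * w * t / (Real.pi ^ 2 * (1 - z)) := by positivity
        linarith

/-- Triangle inequality: the exponential adds `1` to the partial-sum bound, whence the leading `2`
in `D_n`. -/
theorem kernel_bound_outside (hx : 0 ≤ t) (hw : 0 < w) (hxn : w * t / Real.pi < n) (x : ℝ) :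
    ‖∑ j ∈ Finset.range (2 * n + 1 + 1),
        (errCoef w n t j : ℂ) * Complex.exp (Complex.I * errNode w n t j * x)‖ ≤
      coeffD w n t := by
  have hp := Real.pi_pos
  rw [sum_errCoef_mul_exp hw]
  have h := norm_sum_cardTerm_le (w * t / Real.pi) (Real.pi * x / w) n (by positivity) hxn
  have e : Real.pi * (w * t / Real.pi) = w * t := by field_simp
  rw [e] at h
  refine (norm_sub_le _ _).trans ?_
  have h1 : ‖Complex.exp (Complex.I * (w * t / Real.pi : ℝ) * (Real.pi * x / w : ℝ))‖ = 1 := by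
    rw [show Complex.I * ((w * t / Real.pi : ℝ) : ℂ) * ((Real.pi * x / w : ℝ) : ℂ) =
      ((w * t / Real.pi * (Real.pi * x / w) : ℝ) : ℂ) * Complex.I by push_cast; ring,
      Complex.norm_exp_ofReal_mul_I]
  rw [h1, coeffD]
  linarith

theorem sineIntegral_pi_nonneg : 0 ≤ sineIntegral Real.pi :=
  (abs_nonneg _).trans (abs_sinSum_le 0 0)

theorem two_le_coeffD (hx : 0 ≤ t) (hw : 0 < w) (hxn : w * t / Real.pi < n) :
    2 ≤ coeffD w n t := by
  have hp := Real.pi_pos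
  have := sineIntegral_pi_nonneg
  have : 0 < (n : ℝ) - w * t / Real.pi := by linarith
  rw [coeffD]
  have : 0 ≤ 2 * |Real.sin (w * t)| / Real.pi *
    (1 + sineIntegral Real.pi + (w * t / Real.pi + 1 / 2) / ((n : ℝ) - w * t / Real.pi)) := by
    positivity
  linarith

variable {Ω : Type*} [MeasurableSpace Ω] {P : Measure Ω} {X : ℝ → Ω → ℝ} {F : Measure ℝ}

theorem covFun_zero_eq (hF : IsSpectralMeasure P X F) : covFun P X 0 = F.real Set.univ := by
  rw [covFun_eq_integral_cos hF]
  simp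

theorem sqrt_coeffC (hx : 0 ≤ t) (hw : 0 < w) (hΛw : Λ < w) (hz : 0 < z) (hz1 : z < 1)
    (B0 : ℝ) : √(coeffC B0 w z Λ n t) = √B0 * (4 * w * t / (Real.pi ^ 2 * (1 - z)) +
        4 * (z + 1 + 1 / (n : ℝ)) / (Real.pi * (1 - z) ^ 2 * (1 - Λ / w))) := by
  have hz' : 0 < 1 - z := by linarith
  have hL : 0 < 1 - Λ / w := by
    have := (div_lt_one hw).2 hΛw
    linarith
  have hp := Real.pi_pos
  rw [coeffC, mul_comm, Real.sqrt_mul (sq_nonneg _), Real.sqrt_sq (by positivity), mul_comm]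

/-- The mean square bound for the truncation error of the sampling series. -/
theorem sqrt_integral_sq_le_boundA (hX : IsStationary P X) (hF : IsSpectralMeasure P X F)
    (hx : 0 ≤ t) (hw : 0 < w) (hΛw : Λ < w) (hz : 0 < z) (hz1 : z < 1)
    (hn0 : 0 < n) (hxn : w * t / Real.pi ≤ √z * n) :
    √(∫ ω, (∑ j ∈ Finset.range (2 * n + 1 + 1), errCoef w n t j * X (errNode w n t j) ω) ^ 2 ∂P) ≤
      boundA P X F w z Λ n t := by
  have := hF.finite
  have hn' : (0 : ℝ) < n := Nat.cast_pos.2 hn0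
  have hs1 : √z < 1 := by rw [Real.sqrt_lt' one_pos]; simpa using hz1
  have hyn : w * t / Real.pi < n := hxn.trans_lt (by nlinarith)
  have hD := two_le_coeffD hx hw hyn
  have hp := Real.pi_pos
  rw [integral_sq_sum_eq hX hF, boundA, sqrt_coeffC hx hw hΛw hz hz1, covFun_zero_eq hF]
  set C := 4 * w * t / (Real.pi ^ 2 * (1 - z)) +
        4 * (z + 1 + 1 / (n : ℝ)) / (Real.pi * (1 - z) ^ 2 * (1 - Λ / w)) with hC
  have hC0 : 0 ≤ C := by
    have hz' : 0 < 1 - z := by linarith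
    have hL : 0 < 1 - Λ / w := by
      have := (div_lt_one hw).2 hΛw
      linarith
    positivity
  set S := {x : ℝ | Λ < |x|} with hS
  have hSm : MeasurableSet S := measurableSet_lt measurable_const measurable_norm
  refine Real.sqrt_le_iff.2 ⟨by positivity, ?_⟩
  -- Both kernel bounds merge into one majorant. After integration its two parts are squares `a²`
  -- and `b²`, and `a² + b² ≤ (a + b)²` gives the sum of roots in `A_n`.
  have hle : ∀ x : ℝ, ‖∑ j ∈ Finset.range (2 * n + 1 + 1),
        (errCoef w n t j : ℂ) * Complex.exp (Complex.I * errNode w n t j * x)‖ ^ 2 ≤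
      (C / n) ^ 2 + S.indicator (fun _ => coeffD w n t ^ 2) x := by
    intro x
    by_cases h : x ∈ S
    · rw [Set.indicator_of_mem h]
      have := pow_le_pow_left₀ (norm_nonneg _) (kernel_bound_outside hx hw hyn x) 2
      nlinarith [sq_nonneg (C / n)]
    · rw [Set.indicator_of_notMem h, add_zero]
      exact pow_le_pow_left₀ (norm_nonneg _)
        (kernel_bound_inside hx hw hΛw hz hz1 hn0 hxn (not_lt.1 h)) 2
  have hi : Integrable (S.indicator fun _ => coeffD w n t ^ 2) F :=
    (integrable_const _).indicator hSm
  calc _ ≤ ∫ x, ((C / n) ^ 2 + S.indicator (fun _ => coeffD w n t ^ 2) x) ∂F :=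
        integral_mono_of_nonneg (ae_of_all _ fun x => sq_nonneg _)
          ((integrable_const _).add hi) (ae_of_all _ hle)
    _ = (C / n) ^ 2 * F.real Set.univ + coeffD w n t ^ 2 * F.real S := by
        rw [integral_add (integrable_const _) hi, integral_const, integral_indicator_const _ hSm]
        simp only [smul_eq_mul]
        ring
    _ ≤ _ := by
        have e1 := Real.sq_sqrt (measureReal_nonneg (μ := F) (s := Set.univ))
        have e2 := Real.sq_sqrt (measureReal_nonneg (μ := F) (s := S))
        nth_rewrite 1 [← e1]
        nth_rewrite 1 [← e2]
        have : 0 ≤ (√(F.real Set.univ) * C / n) * (coeffD w n t * √(F.real S)) := by positivity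
        have e3 : (C / n) ^ 2 * √(F.real Set.univ) ^ 2 = (√(F.real Set.univ) * C / n) ^ 2 := by
          ring
        rw [e3]
        nlinarith

end Bounds

/-! ### N-functions and their densities. -/

namespace IsNFunction

variable {φ : ℝ → ℝ}

theorem nonneg (hφ : IsNFunction φ) (x : ℝ) : 0 ≤ φ x := by
  have h := hφ.convex.2 (Set.mem_univ x) (Set.mem_univ (-x))
    (by norm_num : (0 : ℝ) ≤ 1 / 2) (by norm_num : (0 : ℝ) ≤ 1 / 2) (by norm_num)
  simp only [smul_eq_mul, hφ.even] at h
  rw [show (1 / 2 : ℝ) * x + 1 / 2 * -x = 0 by ring, hφ.map_zero] at h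
  linarith

theorem monotoneOn (hφ : IsNFunction φ) : MonotoneOn φ (Set.Ici 0) := by
  intro a ha b hb hab
  rcases (Set.mem_Ici.1 ha).eq_or_lt with h | h
  · rw [← h, hφ.map_zero]; exact hφ.nonneg b
  · exact hφ.strictMonoOn.monotoneOn h (h.trans_le hab) hab

/-- Superlinear growth and the intermediate value theorem. Existence of a preimage is what makes
`Function.invFunOn` a true inverse in `phiInv`. -/
theorem surjOn (hφ : IsNFunction φ) {y : ℝ} (hy : 0 ≤ y) : ∃ a ∈ Set.Ici (0 : ℝ), φ a = y := by
  obtain ⟨x, hx, hx1⟩ :=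
    ((hφ.tendsto_atTop.eventually_ge_atTop y).and (eventually_ge_atTop 1)).exists
  have h1 : y ≤ φ x := by
    rw [le_div_iff₀ (by linarith)] at hx
    nlinarith
  obtain ⟨a, ha, hay⟩ := intermediate_value_Icc (by linarith : (0 : ℝ) ≤ x)
    hφ.continuous.continuousOn ⟨hφ.map_zero.le.trans hy, h1⟩
  exact ⟨a, ha.1, hay⟩

theorem phiInv_nonneg (hφ : IsNFunction φ) {y : ℝ} (hy : 0 ≤ y) : 0 ≤ phiInv φ y :=
  Function.invFunOn_mem (hφ.surjOn hy)

theorem apply_phiInv (hφ : IsNFunction φ) {y : ℝ} (hy : 0 ≤ y) : φ (phiInv φ y) = y :=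
  Function.invFunOn_eq (hφ.surjOn hy)

end IsNFunction

theorem IsDensity.nonneg {φ f : ℝ → ℝ} (hf : IsDensity φ f) {x : ℝ} (hx : 0 ≤ x) : 0 ≤ f x := by
  rw [← hf.map_zero]
  exact hf.monotoneOn Set.self_mem_Ici hx hx

/-- If the density at `b` is below `y`, then `y u - φ u` is not larger on `(-∞, b]` than at `b`. -/
theorem IsDensity.mul_sub_le {φ f : ℝ → ℝ} (hφ : IsNFunction φ) (hf : IsDensity φ f)
    {y b u : ℝ} (hb : 0 ≤ b) (hfb : f b ≤ y) (hu : u ≤ b) : y * u - φ u ≤ y * b - φ b := by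
  have hy : 0 ≤ y := (hf.nonneg hb).trans hfb
  -- On `[0, b]` the density is at most `f b ≤ y`, so `φ` grows no faster than `y u`. For negative
  -- `u` both `y u` and `-φ u` are nonpositive, so comparison with `0` suffices.
  have key : ∀ v, 0 ≤ v → v ≤ b → y * v - φ v ≤ y * b - φ b := by
    intro v hv hvb
    have hi : ∀ c d, 0 ≤ c → c ≤ d → IntervalIntegrable f volume c d := fun c d hc hcd =>
      MonotoneOn.intervalIntegrable (hf.monotoneOn.mono (by
        rw [Set.uIcc_of_le hcd]; intro x hx; exact hc.trans hx.1))
    have h1 : φ b - φ v = ∫ x in v..b, f x := by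
      rw [hf.eq_integral b, hf.eq_integral v, abs_of_nonneg hb, abs_of_nonneg hv]
      exact intervalIntegral.integral_interval_sub_left (hi 0 b le_rfl hb) (hi 0 v le_rfl hv)
    have h2 : ∫ x in v..b, f x ≤ ∫ _ in v..b, f b := by
      refine intervalIntegral.integral_mono_on hvb (hi v b hv hvb) intervalIntegrable_const ?_
      intro x hx
      exact hf.monotoneOn (hv.trans hx.1) hb hx.2
    rw [intervalIntegral.integral_const, smul_eq_mul] at h2
    nlinarith [mul_le_mul_of_nonneg_left hfb (sub_nonneg.2 hvb)]
  rcases le_total 0 u with h | h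
  · exact key u h hu
  · refine le_trans ?_ (key 0 le_rfl hb)
    rw [hφ.map_zero]
    nlinarith [hφ.nonneg u]

/-! ### From `τ_φ` to exponential moments. -/

section ExpMoments

variable {Ω : Type*} [MeasurableSpace Ω] {P : Measure Ω}

/-- No independence is available, so sums are split by `e^{a+b} ≤ e^{2a} + e^{2b}`. The coefficients
double at each step, which is why the induction quantifies over all `c`. -/
theorem integrable_exp_sum {ι : Type*} (s : Finset ι) (ξ : ι → Ω → ℝ)
    (hm : ∀ i ∈ s, AEMeasurable (ξ i) P)
    (h : ∀ i ∈ s, ∀ l : ℝ, Integrable (fun ω => Real.exp (l * ξ i ω)) P) [IsFiniteMeasure P] :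
    ∀ c : ι → ℝ, Integrable (fun ω => Real.exp (∑ i ∈ s, c i * ξ i ω)) P := by
  classical
  induction s using Finset.induction_on with
  | empty => intro c; simp
  | insert i s hi ih =>
    intro c
    have h1 := h i (Finset.mem_insert_self _ _) (2 * c i)
    have h2 := ih (fun j hj => hm j (Finset.mem_insert_of_mem hj))
      (fun j hj => h j (Finset.mem_insert_of_mem hj)) (fun j => 2 * c j)
    refine (h1.add h2).mono' ?_ (ae_of_all _ fun ω => ?_)
    · refine (Real.measurable_exp.comp_aemeasurable ?_).aestronglyMeasurable
      exact Finset.aemeasurable_fun_sum _ fun j hj => (hm j hj).const_mul _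
    · rw [Real.norm_eq_abs, Real.abs_exp, Finset.sum_insert hi, Pi.add_apply]
      simp only [mul_assoc, ← Finset.mul_sum]
      generalize c i * ξ i ω = a
      generalize ∑ j ∈ s, c j * ξ j ω = b
      rw [two_mul, two_mul, Real.exp_add, Real.exp_add, Real.exp_add]
      nlinarith [sq_nonneg (Real.exp a - Real.exp b), sq_nonneg (Real.exp a),
        sq_nonneg (Real.exp b)]

/-- A bound on `τ_φ` controls all exponential moments. -/
theorem integral_exp_le_of_tau_le [IsProbabilityMeasure P] {φ : ℝ → ℝ} (hφ : IsNFunction φ)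
    {ξ : Ω → ℝ} {K : ℝ} (hK : 0 ≤ K) (hi : Integrable ξ P) (h0 : ∫ ω, ξ ω ∂P = 0)
    (he : ∀ l : ℝ, Integrable (fun ω => Real.exp (l * ξ ω)) P)
    (hτ : tau φ P ξ ≤ ENNReal.ofReal K) (l : ℝ) :
    ∫ ω, Real.exp (l * ξ ω) ∂P ≤ Real.exp (φ (K * l)) := by
  rcases eq_or_ne l 0 with rfl | hl
  · simp [hφ.map_zero]
  -- Zero mean and `1 + x ≤ e^x` make the logarithm nonnegative, i.e. in the range where `phiInv`
  -- inverts `φ`.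
  have h1 : 1 ≤ ∫ ω, Real.exp (l * ξ ω) ∂P := by
    have : ∫ ω, (l * ξ ω + 1) ∂P ≤ ∫ ω, Real.exp (l * ξ ω) ∂P :=
      integral_mono ((hi.const_mul l).add (integrable_const 1)) (he l)
        fun ω => Real.add_one_le_exp _
    rw [integral_add (hi.const_mul l) (integrable_const 1), integral_const_mul, h0] at this
    simpa using this
  have hlog := Real.log_nonneg h1
  have h2 : ENNReal.ofReal (phiInv φ (Real.log (∫ ω, Real.exp (l * ξ ω) ∂P)) / |l|) ≤
      ENNReal.ofReal K := le_trans (le_iSup₂ (f := fun (l : ℝ) (_ : l ≠ 0) =>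
        ENNReal.ofReal (phiInv φ (Real.log (∫ ω, Real.exp (l * ξ ω) ∂P)) / |l|)) l hl) hτ
  rw [ENNReal.ofReal_le_ofReal_iff hK, div_le_iff₀ (abs_pos.2 hl)] at h2
  have h3 := hφ.monotoneOn (hφ.phiInv_nonneg hlog)
    ((hφ.phiInv_nonneg hlog).trans h2) h2
  rw [hφ.apply_phiInv hlog] at h3
  have h4 : φ (K * |l|) = φ (K * l) := by
    rcases abs_choice l with h | h
    · rw [h]
    · rw [h, mul_neg, hφ.even]
  rw [h4] at h3
  rw [← Real.exp_log (by linarith : 0 < ∫ ω, Real.exp (l * ξ ω) ∂P)]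
  exact Real.exp_le_exp.2 h3

/-- From `e^{|x|} ≤ e^x + e^{-x}` and evenness of `φ`; this is the origin of the factor `2` in the
tail bound. -/
theorem lintegral_exp_abs_le [IsProbabilityMeasure P] {φ : ℝ → ℝ} (hφ : IsNFunction φ)
    {ξ : Ω → ℝ} {K : ℝ} (hK : 0 < K)
    (he : ∀ l : ℝ, Integrable (fun ω => Real.exp (l * ξ ω)) P)
    (hb : ∀ l : ℝ, ∫ ω, Real.exp (l * ξ ω) ∂P ≤ Real.exp (φ (K * l))) (v : ℝ) :
    ∫⁻ ω, ENNReal.ofReal (Real.exp (v * |ξ ω| / K)) ∂P ≤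
      ENNReal.ofReal (2 * Real.exp (φ v)) := by
  have h1 : Integrable (fun ω => Real.exp (v / K * ξ ω) + Real.exp (-(v / K) * ξ ω)) P :=
    (he _).add (he _)
  calc _ ≤ ∫⁻ ω, ENNReal.ofReal (Real.exp (v / K * ξ ω) + Real.exp (-(v / K) * ξ ω)) ∂P := by
        refine lintegral_mono fun ω => ENNReal.ofReal_le_ofReal ?_
        have p1 := Real.exp_pos (v / K * ξ ω)
        have p2 := Real.exp_pos (-(v / K) * ξ ω)
        rcases abs_choice (ξ ω) with h | h
        · rw [h, show v * ξ ω / K = v / K * ξ ω by ring]; linarith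
        · rw [h, show v * -ξ ω / K = -(v / K) * ξ ω by ring]; linarith
    _ = ENNReal.ofReal (∫ ω, (Real.exp (v / K * ξ ω) + Real.exp (-(v / K) * ξ ω)) ∂P) := by
        rw [ofReal_integral_eq_lintegral_ofReal h1 (ae_of_all _ fun ω => by positivity)]
    _ ≤ _ := by
        refine ENNReal.ofReal_le_ofReal ?_
        rw [integral_add (he _) (he _)]
        have b1 := hb (v / K)
        have b2 := hb (-(v / K))
        rw [show K * (v / K) = v by field_simp] at b1
        rw [show K * -(v / K) = -v by field_simp, hφ.even] at b2
        linarith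

end ExpMoments

/-! ### Tail bounds for `∫ |Y|^p`. -/

section Tail

/-- Bernoulli's inequality turns an exponential into a bound for a power. -/
theorem rpow_le_of_exp {p s r : ℝ} (hp : 1 ≤ p) (hps : p ≤ s) (hr : 0 ≤ r) :
    r ^ p ≤ (1 - p / s) + p / s * Real.exp (s * r - s) := by
  have hp0 : 0 < p := by linarith
  have hs0 : 0 < s := by linarith
  -- The tangent inequality `r ≤ e^{r-1}` raised to the power `s`. It is sharp at `r = 1`, as is
  -- Bernoulli with exponent `s/p` below, so no constant is lost.
  have h1 : r ^ s ≤ Real.exp (s * r - s) := by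
    have h := Real.add_one_le_exp (r - 1)
    rw [sub_add_cancel] at h
    have := Real.rpow_le_rpow hr h hs0.le
    rwa [← Real.exp_mul, show (r - 1) * s = s * r - s by ring] at this
  have h2 : 1 + s / p * (r ^ p - 1) ≤ r ^ s := by
    have := one_add_mul_self_le_rpow_one_add (s := r ^ p - 1)
      (by linarith [Real.rpow_nonneg hr p]) ((one_le_div hp0).2 hps)
    rwa [add_sub_cancel, ← Real.rpow_mul hr, mul_div_cancel₀ _ hp0.ne'] at this
  have h3 := mul_le_mul_of_nonneg_left (h2.trans h1) (div_pos hp0 hs0).le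
  have h4 : p / s * (1 + s / p * (r ^ p - 1)) = p / s + (r ^ p - 1) := by
    field_simp
  linarith

variable {α : Type*} [MeasurableSpace α] {μ : Measure α} {τ y : α → ℝ} {p v c : ℝ}

/-- The choice `s = cv`, `r = |a|/(cτ)` makes the exponent `v|a|/τ - cv`. The weights `1 - p/s` and
`p/s` are convex, so a functional of size `S e^{cv}` corresponds exactly to `∫ |Y|^p = c^p S`. -/
theorem abs_rpow_le {p v c a τ : ℝ} (hp : 1 ≤ p) (hc : 0 < c) (hτ : 0 < τ) (hpv : p ≤ c * v) :
    |a| ^ p ≤ c ^ p * ((1 - p / (c * v)) * τ ^ p +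
      p / (c * v) * Real.exp (-(c * v)) * (τ ^ p * Real.exp (v * |a| / τ))) := by
  have h := rpow_le_of_exp hp hpv (by positivity : 0 ≤ |a| / (c * τ))
  have e1 : c * v * (|a| / (c * τ)) - c * v = v * |a| / τ + -(c * v) := by
    field_simp
    ring
  rw [Real.div_rpow (abs_nonneg a) (by positivity), div_le_iff₀ (by positivity), e1, Real.exp_add,
    Real.mul_rpow hc.le hτ.le] at h
  linarith

theorem integrable_abs_rpow_of_exp (hp : 1 ≤ p) (hc : 0 < c) (hpv : p ≤ c * v)
    (hy : AEMeasurable y μ) (hτ : ∀ᵐ t ∂μ, 0 < τ t) (hτp : Integrable (fun t => τ t ^ p) μ)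
    (he : Integrable (fun t => τ t ^ p * Real.exp (v * |y t| / τ t)) μ) :
    Integrable (fun t => |y t| ^ p) μ := by
  refine (((hτp.const_mul (1 - p / (c * v))).add
    (he.const_mul (p / (c * v) * Real.exp (-(c * v))))).const_mul (c ^ p)).mono'
    ((Real.continuous_rpow_const (by linarith)).measurable.comp_aemeasurable
      (continuous_abs.measurable.comp_aemeasurable hy)).aestronglyMeasurable ?_
  filter_upwards [hτ] with t ht
  rw [Real.norm_eq_abs, abs_of_nonneg (by positivity)]
  exact abs_rpow_le hp hc ht hpv

theorem integral_abs_rpow_le_of_exp (hp : 1 ≤ p) (hc : 0 < c) (hpv : p ≤ c * v)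
    (hτ : ∀ᵐ t ∂μ, 0 < τ t) (hτp : Integrable (fun t => τ t ^ p) μ)
    (he : Integrable (fun t => τ t ^ p * Real.exp (v * |y t| / τ t)) μ)
    (hle : ∫ t, τ t ^ p * Real.exp (v * |y t| / τ t) ∂μ ≤
      (∫ t, τ t ^ p ∂μ) * Real.exp (c * v)) :
    ∫ t, |y t| ^ p ∂μ ≤ c ^ p * ∫ t, τ t ^ p ∂μ := by
  have hs : 0 < c * v := by linarith
  calc ∫ t, |y t| ^ p ∂μ ≤ ∫ t, c ^ p * ((1 - p / (c * v)) * τ t ^ p +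
      p / (c * v) * Real.exp (-(c * v)) * (τ t ^ p * Real.exp (v * |y t| / τ t))) ∂μ := by
        refine integral_mono_of_nonneg (ae_of_all _ fun t => by positivity)
          (((hτp.const_mul _).add (he.const_mul _)).const_mul _) ?_
        filter_upwards [hτ] with t ht
        exact abs_rpow_le hp hc ht hpv
    _ = c ^ p * ((1 - p / (c * v)) * (∫ t, τ t ^ p ∂μ) +
      p / (c * v) * Real.exp (-(c * v)) *
        ∫ t, τ t ^ p * Real.exp (v * |y t| / τ t) ∂μ) := by
        rw [integral_const_mul, integral_add (hτp.const_mul _) (he.const_mul _),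
          integral_const_mul, integral_const_mul]
    _ ≤ c ^ p * ((1 - p / (c * v)) * (∫ t, τ t ^ p ∂μ) +
      p / (c * v) * Real.exp (-(c * v)) * ((∫ t, τ t ^ p ∂μ) * Real.exp (c * v))) := by
        gcongr
    _ = _ := by
        have : Real.exp (-(c * v)) * Real.exp (c * v) = 1 := by
          rw [← Real.exp_add, neg_add_cancel, Real.exp_zero]
        linear_combination (c ^ p * (p / (c * v)) * ∫ t, τ t ^ p ∂μ) * this

variable {Ω : Type*} [MeasurableSpace Ω] {P : Measure Ω}
  {Y : α → Ω → ℝ} {φ : ℝ → ℝ}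

/-- The weighted exponential moment along a path. -/
def expFunctional (μ : Measure α) (τ : α → ℝ) (p v : ℝ) (y : α → ℝ) : ENNReal :=
  ∫⁻ t, ENNReal.ofReal (τ t ^ p * Real.exp (v * |y t| / τ t)) ∂μ

theorem aemeasurable_weight (hτm : AEMeasurable τ μ)
    (hY : AEMeasurable (fun q : α × Ω => Y q.1 q.2) (μ.prod P)) (p v : ℝ) :
    AEMeasurable (fun q : α × Ω => ENNReal.ofReal
      (τ q.1 ^ p * Real.exp (v * |Y q.1 q.2| / τ q.1))) (μ.prod P) := by
  have h1 : AEMeasurable (fun q : α × Ω => τ q.1) (μ.prod P) := hτm.comp_fst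
  have h2 : AEMeasurable (fun q : α × Ω => |Y q.1 q.2|) (μ.prod P) :=
    continuous_abs.measurable.comp_aemeasurable hY
  exact ((h1.pow_const p).mul
    (Real.measurable_exp.comp_aemeasurable ((h2.const_mul v).div h1))).ennreal_ofReal

theorem integrable_weight_of_ne_top {y : α → ℝ} (hτm : AEMeasurable τ μ) (hy : AEMeasurable y μ)
    (hτ : ∀ᵐ t ∂μ, 0 < τ t) (h : expFunctional μ τ p v y ≠ ⊤) :
    Integrable (fun t => τ t ^ p * Real.exp (v * |y t| / τ t)) μ := by
  refine (lintegral_ofReal_ne_top_iff_integrable ?_ ?_).1 h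
  · exact ((hτm.pow_const p).mul (Real.measurable_exp.comp_aemeasurable
      (((continuous_abs.measurable.comp_aemeasurable hy).const_mul v).div
        hτm))).aestronglyMeasurable
  · filter_upwards [hτ] with t ht
    exact mul_nonneg (Real.rpow_nonneg ht.le p) (Real.exp_pos _).le

variable [IsProbabilityMeasure P] [SFinite μ]

theorem aemeasurable_expFunctional (hτm : AEMeasurable τ μ)
    (hY : AEMeasurable (fun q : α × Ω => Y q.1 q.2) (μ.prod P)) (p v : ℝ) :
    AEMeasurable (fun ω => expFunctional μ τ p v fun t => Y t ω) P :=
  (aemeasurable_weight hτm hY p v).prod_swap.lintegral_prod_right'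

theorem lintegral_expFunctional_le (hφ : IsNFunction φ) (hτm : AEMeasurable τ μ)
    (hY : AEMeasurable (fun q : α × Ω => Y q.1 q.2) (μ.prod P))
    (hτ : ∀ᵐ t ∂μ, 0 < τ t) (hτp : Integrable (fun t => τ t ^ p) μ)
    (he : ∀ᵐ t ∂μ, ∀ l : ℝ, Integrable (fun ω => Real.exp (l * Y t ω)) P ∧
      ∫ ω, Real.exp (l * Y t ω) ∂P ≤ Real.exp (φ (τ t * l))) (v : ℝ) :
    ∫⁻ ω, expFunctional μ τ p v (fun t => Y t ω) ∂P ≤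
      ENNReal.ofReal ((∫ t, τ t ^ p ∂μ) * (2 * Real.exp (φ v))) := by
  simp only [expFunctional]
  rw [← lintegral_lintegral_swap (aemeasurable_weight hτm hY p v)]
  have hnn : 0 ≤ᵐ[μ] fun t => τ t ^ p := by
    filter_upwards [hτ] with t ht
    exact Real.rpow_nonneg ht.le p
  rw [ENNReal.ofReal_mul (integral_nonneg_of_ae hnn),
    ofReal_integral_eq_lintegral_ofReal hτp hnn, ← lintegral_mul_const'' _
      hτp.aemeasurable.ennreal_ofReal]
  refine lintegral_mono_ae ?_
  filter_upwards [hτ, he] with t ht het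
  simp only [ENNReal.ofReal_mul (Real.rpow_nonneg ht.le p)]
  rw [lintegral_const_mul' _ _ ENNReal.ofReal_ne_top]
  gcongr
  exact lintegral_exp_abs_le hφ ht (fun l => (het l).1) (fun l => (het l).2) v

theorem ae_aemeasurable_path (hY : AEMeasurable (fun q : α × Ω => Y q.1 q.2) (μ.prod P)) :
    ∀ᵐ ω ∂P, AEMeasurable (fun t => Y t ω) μ := by
  filter_upwards [hY.aestronglyMeasurable.prod_swap.prodMk_left] with ω h
  exact h.aemeasurable

theorem ae_integrable_abs_rpow (hφ : IsNFunction φ) (hp : 1 ≤ p) (hτm : AEMeasurable τ μ)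
    (hY : AEMeasurable (fun q : α × Ω => Y q.1 q.2) (μ.prod P))
    (hτ : ∀ᵐ t ∂μ, 0 < τ t) (hτp : Integrable (fun t => τ t ^ p) μ)
    (he : ∀ᵐ t ∂μ, ∀ l : ℝ, Integrable (fun ω => Real.exp (l * Y t ω)) P ∧
      ∫ ω, Real.exp (l * Y t ω) ∂P ≤ Real.exp (φ (τ t * l))) :
    ∀ᵐ ω ∂P, Integrable (fun t => |Y t ω| ^ p) μ := by
  -- Any parameter with `p ≤ cv` would do for finiteness; `v = p`, `c = 1` is the simplest.
  have h := ae_lt_top' (aemeasurable_expFunctional hτm hY p p)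
    ((lintegral_expFunctional_le hφ hτm hY hτ hτp he p).trans_lt ENNReal.ofReal_lt_top).ne
  filter_upwards [h, ae_aemeasurable_path hY] with ω h1 h2
  exact integrable_abs_rpow_of_exp hp one_pos (one_mul p).ge h2 hτ hτp
    (integrable_weight_of_ne_top hτm h2 hτ h1.ne)

/-- The exponential tail bound for `∫ |Y|^p` at a fixed exponential parameter. -/
theorem measureReal_integral_abs_rpow_le (hφ : IsNFunction φ) (hp : 1 ≤ p)
    (hτm : AEMeasurable τ μ) (hY : AEMeasurable (fun q : α × Ω => Y q.1 q.2) (μ.prod P))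
    (hτ : ∀ᵐ t ∂μ, 0 < τ t) (hτp : Integrable (fun t => τ t ^ p) μ)
    (he : ∀ᵐ t ∂μ, ∀ l : ℝ, Integrable (fun ω => Real.exp (l * Y t ω)) P ∧
      ∫ ω, Real.exp (l * Y t ω) ∂P ≤ Real.exp (φ (τ t * l)))
    (hS : 0 < ∫ t, τ t ^ p ∂μ) (hc : 0 < c) (hpv : p ≤ c * v) :
    P.real {ω | c ^ p * ∫ t, τ t ^ p ∂μ < ∫ t, |Y t ω| ^ p ∂μ} ≤
      2 * Real.exp (-(c * v - φ v)) := by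
  set S := ∫ t, τ t ^ p ∂μ with hSdef
  set b := ENNReal.ofReal (S * Real.exp (c * v)) with hb
  have hb0 : b ≠ 0 := by
    rw [hb, Ne, ENNReal.ofReal_eq_zero, not_le]; positivity
  -- By contraposition: a functional below `b` is finite, hence its integrand is integrable and the
  -- deterministic estimate applies to the path.
  have hsub : P {ω | c ^ p * S < ∫ t, |Y t ω| ^ p ∂μ} ≤
      P {ω | b ≤ expFunctional μ τ p v fun t => Y t ω} := by
    refine measure_mono_ae ?_
    filter_upwards [ae_aemeasurable_path hY] with ω hω hlt
    by_contra hcon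
    have hcon' : expFunctional μ τ p v (fun t => Y t ω) < b := not_le.1 hcon
    have hi := integrable_weight_of_ne_top hτm hω hτ (hcon'.trans ENNReal.ofReal_lt_top).ne
    refine absurd hlt (not_lt.2 (integral_abs_rpow_le_of_exp hp hc hpv hτ hτp hi ?_))
    have hnn : 0 ≤ᵐ[μ] fun t => τ t ^ p * Real.exp (v * |Y t ω| / τ t) := by
      filter_upwards [hτ] with t ht
      exact mul_nonneg (Real.rpow_nonneg ht.le p) (Real.exp_pos _).le
    rw [expFunctional, ← ofReal_integral_eq_lintegral_ofReal hi hnn, hb,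
      ENNReal.ofReal_lt_ofReal_iff (by positivity)] at hcon'
    exact hcon'.le
  have hmark := meas_ge_le_lintegral_div (aemeasurable_expFunctional hτm hY p v) hb0
    ENNReal.ofReal_ne_top
  refine ENNReal.toReal_le_of_le_ofReal (by positivity) (hsub.trans (hmark.trans ?_))
  refine (ENNReal.div_le_div_right
    (lintegral_expFunctional_le hφ hτm hY hτ hτp he v) _).trans ?_
  rw [hb, ← ENNReal.ofReal_div_of_pos (by positivity)]
  refine ENNReal.ofReal_le_ofReal (le_of_eq ?_)
  rw [mul_div_mul_left _ _ hS.ne', mul_div_assoc, ← Real.exp_sub, neg_sub]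

/-- The Young-Fenchel tail bound for `∫ |Y|^p`. -/
theorem measureReal_integral_abs_rpow_le_youngFenchel {f : ℝ → ℝ} (hφ : IsNFunction φ)
    (hf : IsDensity φ f) (hp : 1 ≤ p)
    (hτm : AEMeasurable τ μ) (hY : AEMeasurable (fun q : α × Ω => Y q.1 q.2) (μ.prod P))
    (hτ : ∀ᵐ t ∂μ, 0 < τ t) (hτp : Integrable (fun t => τ t ^ p) μ)
    (he : ∀ᵐ t ∂μ, ∀ l : ℝ, Integrable (fun ω => Real.exp (l * Y t ω)) P ∧
      ∫ ω, Real.exp (l * Y t ω) ∂P ≤ Real.exp (φ (τ t * l)))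
    (hS : 0 < ∫ t, τ t ^ p ∂μ) (hc : 0 < c) (hfc : f (p / c) ≤ c) :
    P.real {ω | c ^ p * ∫ t, τ t ^ p ∂μ < ∫ t, |Y t ω| ^ p ∂μ} ≤
      2 * Real.exp (-youngFenchel φ c) := by
  set q := P.real {ω | c ^ p * ∫ t, τ t ^ p ∂μ < ∫ t, |Y t ω| ^ p ∂μ} with hq
  -- Markov's bound covers only `u ≥ p/c`. For smaller `u`, `f (p / c) ≤ c` shows that the exponent
  -- at `p/c` is at least as good.
  have key : ∀ u, q ≤ 2 * Real.exp (-(c * u - φ u)) := by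
    intro u
    rcases le_total (p / c) u with h | h
    · rw [div_le_iff₀ hc, mul_comm] at h
      exact measureReal_integral_abs_rpow_le hφ hp hτm hY hτ hτp he hS hc h
    · have h1 := measureReal_integral_abs_rpow_le hφ hp hτm hY hτ hτp he hS hc
        (mul_div_cancel₀ p hc.ne').ge
      have h2 := hf.mul_sub_le hφ (by positivity : 0 ≤ p / c) hfc h
      refine h1.trans ?_
      gcongr
  have hq0 : 0 ≤ q := measureReal_nonneg
  rcases hq0.eq_or_lt with h | h
  · rw [← h]; positivity
  -- Taking logarithms places all `u` under one upper bound, so the supremum can be taken; this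
  -- needs `q > 0`.
  have : youngFenchel φ c ≤ -Real.log (q / 2) := by
    refine ciSup_le fun u => ?_
    have h1 : q / 2 ≤ Real.exp (-(c * u - φ u)) := by linarith [key u]
    have := (Real.log_le_iff_le_exp (by positivity)).2 h1
    linarith
  have h2 : Real.log (q / 2) ≤ -youngFenchel φ c := by linarith
  rw [Real.log_le_iff_le_exp (by positivity)] at h2
  linarith

end Tail

/-! ### The tail hypotheses for the sampling error. -/

section SamplingError

variable {Ω : Type*} [MeasurableSpace Ω] {P : Measure Ω} {X : ℝ → Ω → ℝ} {F : Measure ℝ}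
  {φ : ℝ → ℝ} {CX w z Λ T t p : ℝ} {n : ℕ}

theorem integrable_exp_errSum [IsProbabilityMeasure P] (hsub : IsStrictlySubProcess φ P X CX)
    (w t l : ℝ) (n : ℕ) :
    Integrable (fun ω => Real.exp (l * (X t ω - truncSum w n X t ω))) P := by
  have h := integrable_exp_sum (P := P) (Finset.range (2 * n + 1 + 1))
    (fun j => X (errNode w n t j))
    (fun j _ => (hsub.isSub _ (Set.mem_range_self _)).integrable.aemeasurable)
    (fun j _ l => by
      obtain ⟨a, -, ha⟩ := (hsub.isSub _ (Set.mem_range_self (errNode w n t j))).exp_bound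
      exact (ha l).1) (fun j => l * errCoef w n t j)
  refine h.congr (ae_of_all _ fun ω => ?_)
  simp only [sub_truncSum_eq, Finset.mul_sum, mul_assoc]

/-- The sampling error satisfies the sub-Gaussian bound with constant `C_X A_n(t, Λ)`. -/
theorem integral_exp_errSum_le [IsProbabilityMeasure P] (hφ : IsNFunction φ)
    (hX : IsStationary P X) (hsub : IsStrictlySubProcess φ P X CX) {K : ℝ}
    (hK : √(∫ ω, (∑ j ∈ Finset.range (2 * n + 1 + 1),
      errCoef w n t j * X (errNode w n t j) ω) ^ 2 ∂P) ≤ K) (l : ℝ) :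
    ∫ ω, Real.exp (l * (X t ω - truncSum w n X t ω)) ∂P ≤ Real.exp (φ (CX * K * l)) := by
  have hK0 : 0 ≤ K := (Real.sqrt_nonneg _).trans hK
  have hi : ∀ j, Integrable (fun ω => errCoef w n t j * X (errNode w n t j) ω) P := fun j =>
    (hsub.isSub _ (Set.mem_range_self _)).integrable.const_mul _
  refine integral_exp_le_of_tau_le hφ (mul_nonneg hsub.pos.le hK0) ?_ ?_
    (fun l => integrable_exp_errSum hsub w t l n) ?_ l
  · simp only [sub_truncSum_eq]
    exact integrable_finsetSum _ fun j _ => hi j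
  · simp only [sub_truncSum_eq]
    rw [integral_finsetSum _ fun j _ => hi j]
    refine Finset.sum_eq_zero fun j _ => ?_
    rw [integral_const_mul, hX.mean_zero, mul_zero]
  · have h := hsub.tau_le (Finset.range (2 * n + 1 + 1)) (fun j => X (errNode w n t j))
      (errCoef w n t) fun j _ => Set.mem_range_self _
    simp only [sub_truncSum_eq]
    exact h.trans (ENNReal.ofReal_le_ofReal (mul_le_mul_of_nonneg_left hK hsub.pos.le))

theorem continuousOn_boundA (P : Measure Ω) (X : ℝ → Ω → ℝ) (F : Measure ℝ)
    (h : ∀ t ∈ Set.Icc 0 T, w * t / Real.pi < n) :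
    ContinuousOn (fun t => boundA P X F w z Λ n t) (Set.Icc 0 T) := by
  have hD : ContinuousOn (fun t => (w * t / Real.pi + 1 / 2) / ((n : ℝ) - w * t / Real.pi))
      (Set.Icc 0 T) :=
    ContinuousOn.div (by fun_prop) (by fun_prop) fun t ht => (sub_pos.2 (h t ht)).ne'
  unfold boundA coeffC coeffD
  refine ContinuousOn.add (by fun_prop) (ContinuousOn.mul ?_ continuousOn_const)
  exact continuousOn_const.add (ContinuousOn.mul (by fun_prop) (continuousOn_const.add hD))

theorem boundA_pos (hF : IsSpectralMeasure P X F) (hB : covFun P X 0 ≠ 0) (hx : 0 ≤ t)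
    (hw : 0 < w) (hΛw : Λ < w) (hz : 0 < z) (hz1 : z < 1) (hn0 : 0 < n)
    (hxn : w * t / Real.pi < n) : 0 < boundA P X F w z Λ n t := by
  have hB0 : 0 < covFun P X 0 := by
    refine lt_of_le_of_ne ?_ hB.symm
    rw [covFun_zero_eq hF]
    exact measureReal_nonneg
  have hz' : 0 < 1 - z := by linarith
  have hL : 0 < 1 - Λ / w := by
    have := (div_lt_one hw).2 hΛw
    linarith
  have hp := Real.pi_pos
  have hn' : (0 : ℝ) < n := Nat.cast_pos.2 hn0
  have hD := two_le_coeffD hx hw hxn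
  rw [boundA, sqrt_coeffC hx hw hΛw hz hz1]
  have h1 := Real.sqrt_pos.2 hB0
  have h2 : 0 ≤ coeffD w n t * √(F.real {x : ℝ | Λ < |x|}) := by positivity
  positivity

theorem boundA_eq_zero (hF : IsSpectralMeasure P X F) (hB : covFun P X 0 = 0) :
    boundA P X F w z Λ n t = 0 := by
  have := hF.finite
  have h : F.real {x : ℝ | Λ < |x|} = 0 := by
    refine le_antisymm ?_ measureReal_nonneg
    rw [← hB, covFun_zero_eq hF]
    exact measureReal_mono (Set.subset_univ _)
  simp [boundA, coeffC, hB, h]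

theorem aemeasurable_sub_truncSum [SFinite P]
    (hXm : AEMeasurable (fun q : ℝ × Ω => X q.1 q.2) ((volume : Measure ℝ).prod P))
    (hX : IsStationary P X) (w T : ℝ) (n : ℕ) :
    AEMeasurable (fun q : ℝ × Ω => X q.1 q.2 - truncSum w n X q.1 q.2)
      ((volume.restrict (Set.Ioc 0 T)).prod P) := by
  have h1 : AEMeasurable (fun q : ℝ × Ω => X q.1 q.2)
      ((volume.restrict (Set.Ioc 0 T)).prod P) :=
    hXm.mono_ac (Measure.AbsolutelyContinuous.prod Measure.absolutelyContinuous_restrict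
      Measure.AbsolutelyContinuous.rfl)
  refine h1.sub (Finset.aemeasurable_fun_sum _ fun k _ => ?_)
  have h2 : AEMeasurable (fun q : ℝ × Ω => X (k * Real.pi / w) q.2)
      ((volume.restrict (Set.Ioc 0 T)).prod P) :=
    (hX.memLp (k * Real.pi / w)).aestronglyMeasurable.aemeasurable.comp_snd
  refine AEMeasurable.mul (Measurable.aemeasurable ?_) h2
  exact Real.continuous_sinc.measurable.comp (by fun_prop)

/-- A process vanishing almost surely at almost every time vanishes along almost every path. -/
theorem ae_ae_eq_zero {α : Type*} [MeasurableSpace α] {μ : Measure α} [SFinite μ] [SFinite P]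
    {Y : α → Ω → ℝ} (hY : AEMeasurable (fun q : α × Ω => Y q.1 q.2) (μ.prod P))
    (h : ∀ᵐ t ∂μ, ∀ᵐ ω ∂P, Y t ω = 0) : ∀ᵐ ω ∂P, ∀ᵐ t ∂μ, Y t ω = 0 := by
  have hm : AEMeasurable (fun q : α × Ω => ‖Y q.1 q.2‖ₑ) (μ.prod P) := hY.enorm
  have h0 : ∫⁻ ω, ∫⁻ t, ‖Y t ω‖ₑ ∂μ ∂P = 0 := by
    rw [← lintegral_lintegral_swap hm]
    refine lintegral_eq_zero_of_ae_eq_zero ?_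
    filter_upwards [h] with t ht
    refine lintegral_eq_zero_of_ae_eq_zero ?_
    filter_upwards [ht] with ω hω
    simp [hω]
  have h0' := (lintegral_eq_zero_iff' hm.prod_swap.lintegral_prod_right').1 h0
  filter_upwards [h0', hY.prod_swap.aestronglyMeasurable.prodMk_left] with ω h1 h2
  have h3 := (lintegral_eq_zero_iff' h2.aemeasurable.enorm).1 h1
  filter_upwards [h3] with t ht
  simpa using ht

theorem ae_sub_truncSum_eq_zero (hX : IsStationary P X)
    (h : ∫ ω, (∑ j ∈ Finset.range (2 * n + 1 + 1),
      errCoef w n t j * X (errNode w n t j) ω) ^ 2 ∂P ≤ 0) :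
    ∀ᵐ ω ∂P, X t ω - truncSum w n X t ω = 0 := by
  have hL : MemLp (fun ω => ∑ j ∈ Finset.range (2 * n + 1 + 1),
      errCoef w n t j * X (errNode w n t j) ω) 2 P :=
    memLp_finsetSum _ fun j _ => (hX.memLp _).const_mul _
  have h0 := le_antisymm h (integral_nonneg fun ω => sq_nonneg _)
  rw [integral_eq_zero_iff_of_nonneg (fun ω => sq_nonneg _) hL.integrable_sq] at h0
  filter_upwards [h0] with ω hω
  rw [sub_truncSum_eq]
  exact pow_eq_zero_iff two_ne_zero |>.1 hω

theorem rpow_div_mul_cancel {ε S p : ℝ} (hε : 0 < ε) (hS : 0 < S) (hp : 0 < p) :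
    ((ε / S) ^ (1 / p)) ^ p * S = ε := by
  rw [← Real.rpow_mul (by positivity), one_div_mul_cancel hp.ne', Real.rpow_one]
  field_simp

/-- With `c = (ε/S)^{1/p}` one has `p/c = p (S/ε)^{1/p}`, so taking `p`-th roots turns the condition
on `ε` into `f(p/c) ≤ c`. -/
theorem density_le_of_mul_rpow_lt {f : ℝ → ℝ} (hf : IsDensity φ f) {ε S p : ℝ} (hε : 0 < ε)
    (hS : 0 < S) (hp : 0 < p) (h : S * f (p * (S / ε) ^ (1 / p)) ^ p < ε) :
    f (p / (ε / S) ^ (1 / p)) ≤ (ε / S) ^ (1 / p) := by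
  have e : p / (ε / S) ^ (1 / p) = p * (S / ε) ^ (1 / p) := by
    rw [div_eq_mul_inv, ← Real.inv_rpow (by positivity), inv_div]
  rw [e]
  have hf0 : 0 ≤ f (p * (S / ε) ^ (1 / p)) := hf.nonneg (by positivity)
  have h1 : f (p * (S / ε) ^ (1 / p)) ^ p ≤ ε / S := by
    rw [le_div_iff₀ hS, mul_comm]; exact h.le
  have h2 := Real.rpow_le_rpow (by positivity) h1 (by positivity : 0 ≤ 1 / p)
  rwa [← Real.rpow_mul hf0, mul_one_div_cancel hp.ne', Real.rpow_one] at h2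

end SamplingError

end WKS

end

/-! ### Main theorem. -/

theorem theorem2 {Ω : Type*} [MeasurableSpace Ω] (P : Measure Ω) [IsProbabilityMeasure P]
    (φ f : ℝ → ℝ) (hφ : WKS.IsNFunction φ) (hQ : WKS.ConditionQ φ) (hf : WKS.IsDensity φ f)
    (X : ℝ → Ω → ℝ) (hXm : AEMeasurable (fun q : ℝ × Ω => X q.1 q.2) ((volume : Measure ℝ).prod P))
    (hX : WKS.IsStationary P X)
    (CX : ℝ) (hsub : WKS.IsStrictlySubProcess φ P X CX)
    (F : Measure ℝ) (hF : WKS.IsSpectralMeasure P X F)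
    (w Λ z T p : ℝ) (n : ℕ) (hΛ : 0 < Λ) (hΛw : Λ < w) (hz : 0 < z) (hz1 : z < 1)
    (hT : 0 < T) (hp : 1 ≤ p) (hn : w * T / (Real.pi * √z) ≤ (n : ℝ)) :
    (∀ᵐ ω ∂P, IntervalIntegrable
      (fun t => |X t ω - WKS.truncSum w n X t ω| ^ p) volume 0 T) ∧
    ∀ ε : ℝ, 0 < ε →
      WKS.boundS P X F CX w z Λ T p n *
          (f (p * (WKS.boundS P X F CX w z Λ T p n / ε) ^ (1 / p))) ^ p < ε →
      P.real {ω | ε < ∫ t in (0 : ℝ)..T, |X t ω - WKS.truncSum w n X t ω| ^ p} ≤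
        if WKS.boundS P X F CX w z Λ T p n = 0 then 0 else
          2 * Real.exp
            (-WKS.youngFenchel φ ((ε / WKS.boundS P X F CX w z Λ T p n) ^ (1 / p))) := by

  have hw : 0 < w := hΛ.trans hΛw
  have hp0 : 0 < p := by linarith
  have hπ := Real.pi_pos
  have hn0 : 0 < n := by
    have hs := Real.sqrt_pos.2 hz
    have : 0 < w * T / (Real.pi * √z) := by positivity
    exact_mod_cast this.trans_le hn
  have hn' : (0 : ℝ) < n := Nat.cast_pos.2 hn0
  have hs1 : √z < 1 := by rw [Real.sqrt_lt' one_pos]; simpa using hz1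
  have hxn : ∀ t ∈ Set.Icc 0 T, w * t / Real.pi ≤ √z * n := fun t ht =>
    WKS.mul_div_pi_le_sqrt_mul hw hz ht.2 hn
  have hxn' : ∀ t ∈ Set.Icc 0 T, w * t / Real.pi < n := fun t ht =>
    (hxn t ht).trans_lt (by nlinarith)
  set μ : Measure ℝ := volume.restrict (Set.Ioc 0 T) with hμ
  have hmem : ∀ᵐ t ∂μ, t ∈ Set.Icc 0 T := by
    filter_upwards [ae_restrict_mem measurableSet_Ioc] with t ht using Set.Ioc_subset_Icc_self ht
  have hY := WKS.aemeasurable_sub_truncSum hXm hX w T n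
  have hσ : ∀ t ∈ Set.Icc 0 T, √(∫ ω, (∑ j ∈ Finset.range (2 * n + 1 + 1),
      WKS.errCoef w n t j * X (WKS.errNode w n t j) ω) ^ 2 ∂P) ≤ WKS.boundA P X F w z Λ n t :=
    fun t ht => WKS.sqrt_integral_sq_le_boundA hX hF ht.1 hw hΛw hz hz1 hn0 (hxn t ht)
  simp only [intervalIntegrable_iff_integrableOn_Ioc_of_le hT.le, IntegrableOn,
    intervalIntegral.integral_of_le hT.le]
  -- If `B(0) = 0`, the spectral measure has zero mass and `A_n` vanishes. The tail estimate, which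
  -- divides by `τ`, is unavailable, but the error is zero along almost every path.
  by_cases hB : WKS.covFun P X 0 = 0
  · have hA : ∀ t, WKS.boundA P X F w z Λ n t = 0 := fun t => WKS.boundA_eq_zero hF hB
    have hS : WKS.boundS P X F CX w z Λ T p n = 0 := by
      simp [WKS.boundS, hA, Real.zero_rpow hp0.ne']
    have hzero : ∀ᵐ ω ∂P, ∀ᵐ t ∂μ, X t ω - WKS.truncSum w n X t ω = 0 := by
      refine WKS.ae_ae_eq_zero hY ?_
      filter_upwards [hmem] with t ht
      refine WKS.ae_sub_truncSum_eq_zero hX ?_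
      have := hσ t ht
      rw [hA t] at this
      exact Real.sqrt_eq_zero'.1 (le_antisymm this (Real.sqrt_nonneg _))
    have hpow : ∀ᵐ ω ∂P, (fun t => |X t ω - WKS.truncSum w n X t ω| ^ p) =ᵐ[μ] fun _ => 0 := by
      filter_upwards [hzero] with ω hω
      filter_upwards [hω] with t ht
      rw [ht, abs_zero, Real.zero_rpow hp0.ne']
    refine ⟨?_, fun ε hε _ => ?_⟩
    · filter_upwards [hpow] with ω hω
      exact (integrable_zero _ _ _).congr hω.symm
    · rw [if_pos hS]
      have hnull : P {ω | ε < ∫ t, |X t ω - WKS.truncSum w n X t ω| ^ p ∂μ} = 0 := by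
        refine measure_eq_zero_iff_ae_notMem.2 ?_
        filter_upwards [hpow] with ω hω hlt
        have h0 : ∫ t, |X t ω - WKS.truncSum w n X t ω| ^ p ∂μ = 0 := by
          rw [integral_congr_ae hω, integral_zero]
        exact absurd (hlt.trans_eq h0) hε.not_gt
      rw [Measure.real, hnull, ENNReal.toReal_zero]
  · have hApos : ∀ t ∈ Set.Icc 0 T, 0 < WKS.boundA P X F w z Λ n t := fun t ht =>
      WKS.boundA_pos hF hB ht.1 hw hΛw hz hz1 hn0 (hxn' t ht)
    -- The weight is the sub-Gaussian constant of the error at time `t`, so that `∫ τ^p` is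
    -- `S_{n,p}`.
    set τ : ℝ → ℝ := fun t => CX * WKS.boundA P X F w z Λ n t with hτdef
    have hτc : ContinuousOn τ (Set.Icc 0 T) :=
      continuousOn_const.mul (WKS.continuousOn_boundA P X F hxn')
    have hτpos : ∀ t ∈ Set.Icc 0 T, 0 < τ t := fun t ht => mul_pos hsub.pos (hApos t ht)
    have hτ : ∀ᵐ t ∂μ, 0 < τ t := by
      filter_upwards [hmem] with t ht using hτpos t ht
    have hτpc : ContinuousOn (fun t => τ t ^ p) (Set.Icc 0 T) :=
      hτc.rpow_const fun t _ => Or.inr hp0.le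
    have hτm : AEMeasurable τ μ :=
      (hτc.mono Set.Ioc_subset_Icc_self).aemeasurable measurableSet_Ioc
    have hτp : Integrable (fun t => τ t ^ p) μ :=
      hτpc.integrableOn_Icc.mono_set Set.Ioc_subset_Icc_self
    have he : ∀ᵐ t ∂μ, ∀ l : ℝ,
        Integrable (fun ω => Real.exp (l * (X t ω - WKS.truncSum w n X t ω))) P ∧
        ∫ ω, Real.exp (l * (X t ω - WKS.truncSum w n X t ω)) ∂P ≤ Real.exp (φ (τ t * l)) := by
      filter_upwards [hmem] with t ht l
      exact ⟨WKS.integrable_exp_errSum hsub w t l n,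
        WKS.integral_exp_errSum_le hφ hX hsub (hσ t ht) l⟩
    have hSeq : WKS.boundS P X F CX w z Λ T p n = ∫ t, τ t ^ p ∂μ := by
      rw [WKS.boundS, intervalIntegral.integral_of_le hT.le, ← integral_const_mul]
      refine integral_congr_ae ?_
      filter_upwards [hmem] with t ht
      rw [hτdef, Real.mul_rpow hsub.pos.le (hApos t ht).le]
    have hS : 0 < ∫ t, τ t ^ p ∂μ := by
      rw [hμ, ← intervalIntegral.integral_of_le hT.le]
      exact intervalIntegral.intervalIntegral_pos_of_pos_on
        (hτpc.intervalIntegrable_of_Icc hT.le)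
        (fun t ht => Real.rpow_pos_of_pos (hτpos t (Set.Ioo_subset_Icc_self ht)) p) hT
    refine ⟨WKS.ae_integrable_abs_rpow hφ hp hτm hY hτ hτp he, fun ε hε hlt => ?_⟩
    rw [hSeq] at hlt ⊢
    rw [if_neg hS.ne']
    have h := WKS.measureReal_integral_abs_rpow_le_youngFenchel hφ hf hp hτm hY hτ hτp he hS
      (c := (ε / ∫ t, τ t ^ p ∂μ) ^ (1 / p)) (by positivity)
      (WKS.density_le_of_mul_rpow_lt hf hε hS hp0 hlt)
    rwa [WKS.rpow_div_mul_cancel hε hS hp0] at h
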